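/- **Setting.** For each $n$ let $Z_1,\dots,Z_n$ be i.i.d. real random variables with distribution $P$. Assume: (A) for some $\delta>0$, $P$ is absolutely continuous on $(-\delta,\delta)$ with a density $f$ that has one-sided limits $f^+(0)=\lim_{z\downarrow0}f(z)$ and $f^-(0)=\lim_{z\uparrow0}f(z)$, and there is $C\in(0,\infty)$ with $|f(z)-f^+(0)|\le C|z|$ for $z\in(0,\delta)$ and $|f(z)-f^-(0)|\le C|z|$ for $z\in(-\delta,0)$; (B) $f^-(0)+f^+(0)>0$. Put $\pi_f=f^+(0)/(f^-(0)+f^+(0))$. For a positive integer $q$, order the observations by absolute value (ties broken arbitrarily) and let $S_n$ be the number of non-negative values among the $q$ observations closest to $0$. Let $\Psi_q$ be the distribution function of the binomial distribution with $q$ trials and success probability $\tfrac12$. For $\alpha\in(0,1)$ let $b_q(\alpha)$ be the unique $b\in\{0,\dots,\lfloor q/2\rfloor\}$ with $\Psi_q(b-1)\le\alpha/2<\Psi_q(b)$, and set $$T_q(s)=\sqrt q\,\Big|\frac sq-\frac12\Big|,\qquad c_q(\alpha)=\sqrt q\Big(\frac12-\frac{b_q(\alpha)}q\Big),\qquad a_q(\alpha)=2^{q-1}\binom{q}{b_q(\alpha)}^{-1}\big[\alpha-2\Psi_q(b_q(\alpha)-1)\big].$$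 The level-$\alpha$ test is $\phi(s)=1$ if $T_q(s)>c_q(\alpha)$, $\phi(s)=a_q(\alpha)$ if $T_q(s)=c_q(\alpha)$, and $\phi(s)=0$ if $T_q(s)<c_q(\alpha)$. **Theorem.** Let $q=q_n\to\infty$ with $q^{3/2}/n\to0$ as $n\to\infty$. If $P$ satisfies (A) and (B), then $$\sqrt q\Big(\frac1qS_n-\pi_f\Big)\xrightarrow{d}N\big(0,\pi_f(1-\pi_f)\big),$$ where $N(0,0)$ is the point mass at $0$. Moreover, for every $\alpha\in(0,1)$: (a) if $f^+(0)=f^-(0)$, then $\lim_{n\to\infty}E[\phi(S_n)]=\alpha$; (b) if $f^+(0)\ne f^-(0)$, then $\lim_{n\to\infty}E[\phi(S_n)]=1$; (c) suppose that, for each $n$, the sample $Z_1,\dots,Z_n$ is instead i.i.d. from a distribution $P_n$, where all $P_n$ satisfy (A) with the same constants $\delta$ and $C$ and $f_n^-(0)+f_n^+(0)\ge\kappa$ for some $\kappa>0$ that does not depend on $n$. If $\sqrt q\,(\pi_{f_n}-\tfrac12)\to\Delta\ne0$, then $$\lim_{n\to\infty}E[\phi(S_n)]=P\{|\zeta+2\Delta|>z_{\alpha/2}\}>\alpha,$$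 where $\zeta\sim N(0,1)$ and $z_{\alpha/2}$ is the $(1-\tfrac\alpha2)$-quantile of $\zeta$. -/

import Mathlib

open MeasureTheory ProbabilityTheory Filter Set Topology

noncomputable section

namespace SignTest

/-- `Z 0, …, Z (n-1)` are i.i.d. random variables with common law `P`. -/
structure IsIIDSample {Ω : Type*} [MeasurableSpace Ω] (μ : Measure Ω) (P : Measure ℝ) {n : ℕ}
    (Z : Fin n → Ω → ℝ) : Prop where
  hasLaw : ∀ i, HasLaw (Z i) P μ
  indep : iIndepFun Z μ

/-- On `(-δ, δ)` the measure `P` is absolutely continuous with density `f`; the density has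
one-sided limits `fm` (from the left) and `fp` (from the right) at zero and is Lipschitz
at zero on either side, with constant `C`. -/
structure HasLipschitzDensity (P : Measure ℝ) (f : ℝ → ℝ) (δ C fm fp : ℝ) : Prop where
  delta_pos : 0 < δ
  const_pos : 0 < C
  measurable : Measurable f
  nonneg : ∀ z ∈ Ioo (-δ) δ, 0 ≤ f z
  restrict_eq : P.restrict (Ioo (-δ) δ) =
    (volume.restrict (Ioo (-δ) δ)).withDensity (fun z => ENNReal.ofReal (f z))
  tendsto_left : Tendsto f (𝓝[<] 0) (𝓝 fm)
  tendsto_right : Tendsto f (𝓝[>] 0) (𝓝 fp)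
  lipschitz_left : ∀ z ∈ Ioo (-δ) 0, |f z - fm| ≤ C * |z|
  lipschitz_right : ∀ z ∈ Ioo 0 δ, |f z - fp| ≤ C * |z|

/-- `π_f = f⁺(0) / (f⁻(0) + f⁺(0))`. -/
def piF (fm fp : ℝ) : ℝ := fp / (fm + fp)

/-- `zg` lists the values of `z` in an order along which `g` is non-decreasing
(ties may be broken in any way). -/
def IsGOrderStatistics (g : ℝ → ℝ) {n : ℕ} (z zg : Fin n → ℝ) : Prop :=
  (∃ σ : Equiv.Perm (Fin n), zg = z ∘ σ) ∧ Monotone (fun j => g (zg j))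

/-- `s` is the number of non-negative values among the `q` observations of `z` closest to zero. -/
def IsSignStatistic (q : ℕ) {n : ℕ} (z : Fin n → ℝ) (s : ℕ) : Prop :=
  ∃ zg : Fin n → ℝ, IsGOrderStatistics (fun x => |x|) z zg ∧
    s = ∑ j : Fin n with j.val < q, if 0 ≤ zg j then 1 else 0

/-- The cumulative distribution function of the binomial distribution with `q` trials and
success probability `1/2`. -/
def binomCDF (q : ℕ) (b : ℝ) : ℝ :=
  1 / 2 ^ q * (∑ x ∈ Finset.range (⌊b⌋₊ + 1), (q.choose x : ℝ)) *
      (if 0 ≤ b ∧ b ≤ q then 1 else 0) +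
    (if (q : ℝ) < b then 1 else 0)

/-- `b_q(α)`: the only element of the set below, which is a singleton when `0 < α < 1`. -/
def bq (q : ℕ) (α : ℝ) : ℕ :=
  sInf {b : ℕ | b ≤ q / 2 ∧ binomCDF q ((b : ℝ) - 1) ≤ α / 2 ∧ α / 2 < binomCDF q b}

/-- The critical value `c_q(α)`. -/
def cq (q : ℕ) (α : ℝ) : ℝ := √q * (1 / 2 - (bq q α : ℝ) / q)

/-- The rejection probability `a_q(α)` at the critical value. -/
def aq (q : ℕ) (α : ℝ) : ℝ :=
  (2 : ℝ) ^ ((q : ℤ) - 1) * ((q.choose (bq q α) : ℝ))⁻¹ *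
    (α - 2 * binomCDF q ((bq q α : ℝ) - 1))

/-- The test statistic `T_q(s)`. -/
def testStat (q s : ℕ) : ℝ := √q * |(s : ℝ) / q - 1 / 2|

open Classical in
/-- The (randomized) test `φ(s)` of nominal level `α`. -/
def signTest (q : ℕ) (α : ℝ) (s : ℕ) : ℝ :=
  if cq q α < testStat q s then 1
  else if testStat q s = cq q α then aq q α
  else 0

/-- The `p`-quantile of the standard normal distribution. -/
def normalQuantile (p : ℝ) : ℝ := sInf {x : ℝ | p ≤ cdf (gaussianReal 0 1) x}

end SignTest

end

/-! The rank of an observation depends on absolute values only. If signs were independent of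
absolute values, with probability `piF` of being non-negative, `S` would be binomial and its
generating function at `w` would be `(1 + piF * (w - 1)) ^ q`. `norm_integral_pow_sub_le` bounds the
error of this formula for unimodular or smaller `w`.

The argument is a Lindeberg exchange. Inside a window `(-R, R)`, `w ^ S` is a product of one factor
per observation, and these are replaced one at a time by their conditional means. With the other
coordinates frozen, one replacement costs the integral of a centred sign against an even function
supported in the window. At leading order the density takes two constant values, for which `piF`
makes that integral vanish by oddness; the Lipschitz bound leaves `2 * C * R ^ 2`
(`norm_integral_even_mul_le`). The formula fails only if the window holds fewer than `q` points
(exponentially unlikely by `measureReal_card_lt_le`) or there are ties in it (null).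

With `R` of order `q / n` and `w = exp (i t / √q)`, the `n` replacements cost `n * R ^ 2 / √q`, of
order `q ^ (3/2) / n`: this is the rate hypothesis. A Taylor expansion uniform in the success
probability then gives the central limit theorem through characteristic functions.

The same theorem for the exact symmetric binomial law shows that `cq` tends to half a normal
quantile (`tendsto_cq`). Randomization matters only on the boundary of the rejection region, which
an atomless limit does not charge; this settles the null and the local alternatives. Under fixed
alternatives tightness of the centred statistic suffices, so a degenerate limit does no harm. -/

namespace SignTest

/-! ### Characteristic functions of binomial laws with varying success probability -/

/-- The characteristic function of a centred Bernoulli variable. -/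
noncomputable def centredBernoulliCharFun (p s : ℝ) : ℂ :=
  (1 - p) * Complex.exp ((-(s * p) : ℝ) * Complex.I) +
    p * Complex.exp ((s * (1 - p) : ℝ) * Complex.I)

lemma norm_convexComb_le_one {p : ℝ} (h0 : 0 ≤ p) (h1 : p ≤ 1) {a b : ℂ} (ha : ‖a‖ ≤ 1)
    (hb : ‖b‖ ≤ 1) : ‖(1 - p : ℂ) * a + p * b‖ ≤ 1 := by
  have e1 : ‖(1 - p : ℂ)‖ = 1 - p := by
    rw [← Complex.ofReal_one, ← Complex.ofReal_sub, Complex.norm_real, Real.norm_of_nonneg]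
    linarith
  have e2 : ‖(p : ℂ)‖ = p := by rw [Complex.norm_real, Real.norm_of_nonneg h0]
  calc _ ≤ ‖(1 - p : ℂ)‖ * ‖a‖ + ‖(p : ℂ)‖ * ‖b‖ := by
        rw [← norm_mul, ← norm_mul]; exact norm_add_le _ _
    _ ≤ 1 := by rw [e1, e2]; nlinarith

lemma norm_centredBernoulliCharFun_le_one {p : ℝ} (h0 : 0 ≤ p) (h1 : p ≤ 1) (s : ℝ) :
    ‖centredBernoulliCharFun p s‖ ≤ 1 :=
  norm_convexComb_le_one h0 h1 (Complex.norm_exp_ofReal_mul_I _).le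
    (Complex.norm_exp_ofReal_mul_I _).le

lemma norm_exp_mul_I_sub_le {x : ℝ} (hx : |x| ≤ 1) :
    ‖Complex.exp (x * Complex.I) - (1 + x * Complex.I - x ^ 2 / 2)‖ ≤ 3 * |x| ^ 3 := by
  have h := Complex.norm_exp_sub_sum_le_norm_mul_exp (x * Complex.I) 3
  have e : ∑ m ∈ Finset.range 3, ((x : ℂ) * Complex.I) ^ m / (m.factorial : ℂ) =
      1 + x * Complex.I - x ^ 2 / 2 := by
    simp [Finset.sum_range_succ, mul_pow, Complex.I_sq]; ring
  rw [e] at h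
  have e2 : ‖(x : ℂ) * Complex.I‖ = |x| := by simp
  rw [e2] at h
  have : Real.exp |x| ≤ 3 :=
    (Real.exp_le_exp.2 hx).trans (Real.exp_one_lt_d9.le.trans (by norm_num))
  nlinarith [pow_nonneg (abs_nonneg x) 3]

/-- Averaging the two quadratic Taylor polynomials cancels the linear terms and leaves `1 - s ^ 2 *
p * (1 - p) / 2`, the first-order expansion of the Gaussian factor. Three remainders of `3 * |s| ^
3` make up the constant 9. It does not depend on `p`, so `p` may vary with the sample size, even
towards 0 or 1. -/
lemma norm_centredBernoulliCharFun_sub_exp_le {p s : ℝ} (h0 : 0 ≤ p) (h1 : p ≤ 1)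
    (hs : |s| ≤ 1) :
    ‖centredBernoulliCharFun p s - Complex.exp ((-(s ^ 2 * (p * (1 - p)) / 2) : ℝ))‖ ≤
      9 * |s| ^ 3 := by
  have hs0 := abs_nonneg s
  have ha : |(-(s * p))| ≤ |s| := by
    rw [abs_neg, abs_mul, abs_of_nonneg h0]; nlinarith
  have hb : |s * (1 - p)| ≤ |s| := by
    rw [abs_mul, abs_of_nonneg (by linarith : 0 ≤ 1 - p)]; nlinarith
  have A := norm_exp_mul_I_sub_le (ha.trans hs)
  have B := norm_exp_mul_I_sub_le (hb.trans hs)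
  have A' := A.trans (mul_le_mul_of_nonneg_left (pow_le_pow_left₀ (abs_nonneg _) ha 3)
    (by norm_num : (0 : ℝ) ≤ 3))
  have B' := B.trans (mul_le_mul_of_nonneg_left (pow_le_pow_left₀ (abs_nonneg _) hb 3)
    (by norm_num : (0 : ℝ) ≤ 3))
  set v := p * (1 - p) with hv
  have hv0 : 0 ≤ v := mul_nonneg h0 (by linarith)
  have hv1 : v ≤ 1 := by nlinarith
  have h2 : |s| ^ 2 ≤ 1 := pow_le_one₀ hs0 hs
  have hw : |(-(s ^ 2 * v / 2))| ≤ |s| ^ 2 := by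
    rw [abs_neg, abs_of_nonneg (by positivity), sq_abs]; nlinarith [sq_nonneg s]
  have C := Complex.norm_exp_sub_sum_le_norm_mul_exp ((-(s ^ 2 * v / 2) : ℝ) : ℂ) 2
  have e : ∑ m ∈ Finset.range 2, ((-(s ^ 2 * v / 2) : ℝ) : ℂ) ^ m / (m.factorial : ℂ) =
      1 - s ^ 2 * v / 2 := by
    simp [Finset.sum_range_succ]; ring
  rw [e, Complex.norm_real, Real.norm_eq_abs] at C
  have C' : ‖Complex.exp ((-(s ^ 2 * v / 2) : ℝ)) - (1 - s ^ 2 * v / 2)‖ ≤ 3 * |s| ^ 3 := by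
    refine C.trans ?_
    have : Real.exp |(-(s ^ 2 * v / 2))| ≤ 3 :=
      (Real.exp_le_exp.2 (hw.trans h2)).trans (Real.exp_one_lt_d9.le.trans (by norm_num))
    have h3 : |(-(s ^ 2 * v / 2))| ^ 2 ≤ |s| ^ 3 := by
      calc |(-(s ^ 2 * v / 2))| ^ 2 ≤ (|s| ^ 2) ^ 2 := pow_le_pow_left₀ (abs_nonneg _) hw 2
        _ = |s| ^ 3 * |s| := by ring
        _ ≤ |s| ^ 3 * 1 := by gcongr
        _ = _ := by ring
    calc _ ≤ |s| ^ 3 * 3 := by gcongr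
      _ = _ := by ring
  have key : centredBernoulliCharFun p s - Complex.exp ((-(s ^ 2 * v / 2) : ℝ)) =
      ((1 - p : ℂ) * (Complex.exp ((-(s * p) : ℝ) * Complex.I) -
          (1 + (-(s * p) : ℝ) * Complex.I - (-(s * p) : ℝ) ^ 2 / 2)) +
        p * (Complex.exp ((s * (1 - p) : ℝ) * Complex.I) -
          (1 + (s * (1 - p) : ℝ) * Complex.I - (s * (1 - p) : ℝ) ^ 2 / 2))) -
      (Complex.exp ((-(s ^ 2 * v / 2) : ℝ)) - (1 - s ^ 2 * v / 2)) := by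
    rw [centredBernoulliCharFun, hv]
    push_cast
    ring
  rw [key]
  have e1 : ‖(1 - p : ℂ)‖ ≤ 1 := by
    rw [← Complex.ofReal_one, ← Complex.ofReal_sub, Complex.norm_real, Real.norm_of_nonneg]
    all_goals linarith
  have e2 : ‖(p : ℂ)‖ ≤ 1 := by rw [Complex.norm_real, Real.norm_of_nonneg h0]; exact h1
  refine (norm_sub_le _ _).trans ?_
  refine (add_le_add (norm_add_le _ _) C').trans ?_
  rw [norm_mul, norm_mul]
  have := mul_le_mul e1 A' (norm_nonneg _) zero_le_one
  have := mul_le_mul e2 B' (norm_nonneg _) zero_le_one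
  linarith

/-- Changing the factors one at a time costs `‖a - b‖` each, because the untouched factors have norm
at most one. -/
lemma norm_pow_sub_pow_le {a b : ℂ} (ha : ‖a‖ ≤ 1) (hb : ‖b‖ ≤ 1) (n : ℕ) :
    ‖a ^ n - b ^ n‖ ≤ n * ‖a - b‖ := by
  induction n with
  | zero => simp
  | succ n ih =>
    have e : a ^ (n + 1) - b ^ (n + 1) = (a ^ n - b ^ n) * a + b ^ n * (a - b) := by ring
    rw [e]
    refine (norm_add_le _ _).trans ?_
    rw [norm_mul, norm_mul, norm_pow]
    have h1 := mul_le_mul ih ha (norm_nonneg _) (by positivity)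
    have h2 := mul_le_mul_of_nonneg_right (pow_le_one₀ (n := n) (norm_nonneg _) hb)
      (norm_nonneg (a - b))
    push_cast
    linarith

lemma tendsto_natCast_mul_abs_div_sqrt_pow_three {q : ℕ → ℕ} (hq : Tendsto q atTop atTop)
    (t : ℝ) : Tendsto (fun n => (q n : ℝ) * (9 * |t / √(q n : ℝ)| ^ 3)) atTop (𝓝 0) := by
  have hs : Tendsto (fun n => √(q n : ℝ)) atTop atTop :=
    Real.tendsto_sqrt_atTop.comp (tendsto_natCast_atTop_atTop.comp hq)
  have h : Tendsto (fun n => (9 * |t| ^ 3) / √(q n : ℝ)) atTop (𝓝 0) := hs.const_div_atTop _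
  refine h.congr' ?_
  filter_upwards [hs.eventually_gt_atTop 0] with n hn
  rw [abs_div, abs_of_pos hn, div_pow]
  have : (q n : ℝ) = √(q n : ℝ) ^ 2 := (Real.sq_sqrt (Nat.cast_nonneg _)).symm
  rw [this, Real.sqrt_sq hn.le]
  field_simp

/-- Convergence of the characteristic functions in the central limit theorem for binomial
distributions with varying success probability. -/
lemma tendsto_centredBernoulliCharFun_pow {q : ℕ → ℕ} (hq : Tendsto q atTop atTop)
    {p : ℕ → ℝ} (hp : ∀ n, p n ∈ Icc (0 : ℝ) 1) {v : ℝ}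
    (hv : Tendsto (fun n => p n * (1 - p n)) atTop (𝓝 v)) (t : ℝ) :
    Tendsto (fun n => centredBernoulliCharFun (p n) (t / √(q n : ℝ)) ^ q n) atTop
      (𝓝 (Complex.exp ((-(t ^ 2 * v / 2) : ℝ)))) := by
  have hs : Tendsto (fun n => √(q n : ℝ)) atTop atTop :=
    Real.tendsto_sqrt_atTop.comp (tendsto_natCast_atTop_atTop.comp hq)
  have hE : Tendsto (fun n => Complex.exp ((-(t ^ 2 * (p n * (1 - p n)) / 2) : ℝ))) atTop
      (𝓝 (Complex.exp ((-(t ^ 2 * v / 2) : ℝ)))) := by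
    have hc : Continuous fun x : ℝ => Complex.exp ((-(t ^ 2 * x / 2) : ℝ)) := by fun_prop
    exact (hc.tendsto v).comp hv
  have hD : Tendsto (fun n => centredBernoulliCharFun (p n) (t / √(q n : ℝ)) ^ q n -
      Complex.exp ((-(t ^ 2 * (p n * (1 - p n)) / 2) : ℝ))) atTop (𝓝 0) := by
    refine squeeze_zero_norm' ?_ (tendsto_natCast_mul_abs_div_sqrt_pow_three hq t)
    have hsm : Tendsto (fun n => |t / √(q n : ℝ)|) atTop (𝓝 0) := by
      simpa using (hs.const_div_atTop t).abs
    filter_upwards [hs.eventually_gt_atTop 0, hsm.eventually_le_const zero_lt_one] with n hn hn1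
    have hqn : (q n : ℝ) = √(q n : ℝ) ^ 2 := (Real.sq_sqrt (Nat.cast_nonneg _)).symm
    -- The Gaussian is split into `q n` equal factors at scale `t / √q`, to be compared factor by
    -- factor.
    have e : Complex.exp ((-(t ^ 2 * (p n * (1 - p n)) / 2) : ℝ)) =
        Complex.exp ((-((t / √(q n : ℝ)) ^ 2 * (p n * (1 - p n)) / 2) : ℝ)) ^ q n := by
      rw [← Complex.exp_nat_mul]
      congr 1
      rw [← Complex.ofReal_natCast, ← Complex.ofReal_mul]
      congr 1
      have : (q n : ℝ) ≠ 0 := by rw [hqn]; positivity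
      rw [div_pow, Real.sq_sqrt (Nat.cast_nonneg _)]
      field_simp
    rw [e]
    refine (norm_pow_sub_pow_le (norm_centredBernoulliCharFun_le_one (hp n).1 (hp n).2 _) ?_
      _).trans ?_
    · rw [Complex.norm_exp, Complex.ofReal_re, Real.exp_le_one_iff, neg_nonpos]
      have := mul_nonneg (hp n).1 (sub_nonneg.2 (hp n).2)
      positivity
    · gcongr
      exact norm_centredBernoulliCharFun_sub_exp_le (hp n).1 (hp n).2 hn1
  simpa using hD.add hE

/-! ### The observations nearest to zero -/

/-- The indices of the observations in `(-R, R)` with fewer than `q` observations strictly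
closer to zero. -/
noncomputable def nearSet {n : ℕ} (q : ℕ) (R : ℝ) (z : Fin n → ℝ) : Finset (Fin n) :=
  {i | |z i| < R ∧ Finset.card {k : Fin n | |z k| < |z i|} < q}

lemma card_filter_val_lt_of_le {n q : ℕ} (h : q ≤ n) :
    Finset.card {j : Fin n | j.val < q} = q := by
  rw [Fin.card_filter_val_lt]; omega

/-- Without ties in the window, the rank of an observation there equals its position under any
sorting permutation; positions outside the window come after at least `q` others. Hence the first
`q` positions have a description free of the permutation, and ties outside the window are harmless.
-/
lemma nearSet_eq_map {n q : ℕ} {R : ℝ} {z : Fin n → ℝ}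
    (hties : ∀ i j, i ≠ j → |z i| < R → |z i| ≠ |z j|)
    (hcard : q ≤ Finset.card {i : Fin n | |z i| < R}) {σ : Equiv.Perm (Fin n)}
    (hσ : Monotone fun j => |z (σ j)|) :
    nearSet q R z = Finset.map σ.toEmbedding {j : Fin n | j.val < q} := by
  have hle : ∀ j : Fin n, ¬ |z (σ j)| < R → Finset.card {i : Fin n | |z i| < R} ≤ j.val := by
    intro j hj
    have : Finset.card {i : Fin n | |z i| < R} ≤
        Finset.card (Finset.map σ.toEmbedding {k : Fin n | k.val < j.val}) := by
      refine Finset.card_le_card fun i hi => ?_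
      simp only [Finset.mem_filter, Finset.mem_univ, true_and, Finset.mem_map_equiv] at hi ⊢
      by_contra hlt
      have h1 : j ≤ σ.symm i := not_lt.1 hlt
      have := hσ h1
      simp only [Equiv.apply_symm_apply] at this
      exact hj (this.trans_lt hi)
    refine this.trans ?_
    rw [Finset.card_map, card_filter_val_lt_of_le j.2.le]
  have hrank : ∀ j : Fin n, |z (σ j)| < R →
      Finset.card {k : Fin n | |z k| < |z (σ j)|} = j.val := by
    intro j hj
    have : ({k : Fin n | |z k| < |z (σ j)|} : Finset (Fin n)) =
        Finset.map σ.toEmbedding {k : Fin n | k.val < j.val} := by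
      ext i
      simp only [Finset.mem_filter, Finset.mem_univ, true_and, Finset.mem_map_equiv]
      constructor
      · intro hi
        by_contra hlt
        have h1 : j ≤ σ.symm i := not_lt.1 hlt
        have := hσ h1
        simp only [Equiv.apply_symm_apply] at this
        exact absurd hi (not_lt.2 this)
      · intro hi
        have h1 : σ.symm i < j := hi
        have h2 := hσ h1.le
        simp only [Equiv.apply_symm_apply] at h2
        refine lt_of_le_of_ne h2 (Ne.symm (hties _ _ ?_ hj))
        rintro rfl
        simp at h1
    rw [this, Finset.card_map, card_filter_val_lt_of_le j.2.le]
  ext i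
  obtain ⟨j, rfl⟩ := σ.surjective i
  simp only [nearSet, Finset.mem_filter, Finset.mem_univ, true_and, Finset.mem_map_equiv,
    Equiv.symm_apply_apply]
  constructor
  · rintro ⟨h1, h2⟩
    rwa [hrank j h1] at h2
  · intro h
    have h1 : |z (σ j)| < R := by
      by_contra h1
      have := hle j h1
      omega
    exact ⟨h1, by rwa [hrank j h1]⟩

lemma IsSignStatistic.eq_card {n q : ℕ} {R : ℝ} {z : Fin n → ℝ} {s : ℕ}
    (hs : IsSignStatistic q z s)
    (hties : ∀ i j, i ≠ j → |z i| < R → |z i| ≠ |z j|)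
    (hcard : q ≤ Finset.card {i : Fin n | |z i| < R}) :
    (nearSet q R z).card = q ∧ s = Finset.card {i ∈ nearSet q R z | 0 ≤ z i} := by
  obtain ⟨_, ⟨⟨σ, rfl⟩, hmono⟩, rfl⟩ := hs
  have hqn : q ≤ n := hcard.trans ((Finset.card_le_univ _).trans_eq (Fintype.card_fin n))
  rw [nearSet_eq_map hties hcard hmono]
  refine ⟨by rw [Finset.card_map, card_filter_val_lt_of_le hqn], ?_⟩
  rw [Finset.filter_map, Finset.card_map, Finset.card_filter]
  simp

/-- Flipping the sign of an observation does not affect the selection; this is the source of the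
evenness used in the exchange argument. -/
lemma nearSet_congr {n q : ℕ} {R : ℝ} {z z' : Fin n → ℝ} (h : ∀ i, |z i| = |z' i|) :
    nearSet q R z = nearSet q R z' := by
  simp [nearSet, h]

/-! ### Consequences of the one-sided Lipschitz condition -/

namespace HasLipschitzDensity

variable {P : Measure ℝ} {f : ℝ → ℝ} {δ C fm fp : ℝ}

lemma nonneg_left (h : HasLipschitzDensity P f δ C fm fp) : 0 ≤ fm := by
  refine ge_of_tendsto h.tendsto_left ?_
  have : Ioo (-δ) 0 ∈ 𝓝[<] (0 : ℝ) := Ioo_mem_nhdsLT (by linarith [h.delta_pos])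
  filter_upwards [this] with x hx using h.nonneg x ⟨hx.1, hx.2.trans h.delta_pos⟩

lemma nonneg_right (h : HasLipschitzDensity P f δ C fm fp) : 0 ≤ fp := by
  refine ge_of_tendsto h.tendsto_right ?_
  have : Ioo 0 δ ∈ 𝓝[>] (0 : ℝ) := Ioo_mem_nhdsGT h.delta_pos
  filter_upwards [this] with x hx using h.nonneg x ⟨by linarith [hx.1, h.delta_pos], hx.2⟩

lemma piF_mem_Icc (h : HasLipschitzDensity P f δ C fm fp) (hpos : 0 < fm + fp) :
    piF fm fp ∈ Icc (0 : ℝ) 1 :=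
  ⟨div_nonneg h.nonneg_right hpos.le, (div_le_one hpos).2 (by linarith [h.nonneg_left])⟩

lemma apply_eq (h : HasLipschitzDensity P f δ C fm fp) {s : Set ℝ} (hs : s ⊆ Ioo (-δ) δ)
    (hm : MeasurableSet s) : P s = ∫⁻ x in s, ENNReal.ofReal (f x) := by
  rw [← Measure.restrict_eq_self P hs, h.restrict_eq, withDensity_apply _ hm,
    Measure.restrict_restrict hm, inter_eq_left.2 hs]

lemma measure_singleton (h : HasLipschitzDensity P f δ C fm fp) {x : ℝ} (hx : |x| < δ) :
    P {x} = 0 := by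
  rw [h.apply_eq (by simpa using abs_lt.1 hx) (measurableSet_singleton x)]
  simp

/-- The density exceeds `fp - C * R` on the right and `fm - C * R` on the left, so the mass is at
least `(κ - 2 * C * R) * R`, and `2 * C * R ≤ κ / 2`. -/
lemma mul_le_measureReal [IsProbabilityMeasure P] (h : HasLipschitzDensity P f δ C fm fp)
    {R κ : ℝ} (hR : 0 < R) (hRδ : R ≤ δ) (hκ : κ ≤ fm + fp) (hRC : 4 * C * R ≤ κ) :
    κ / 2 * R ≤ P.real (Ioo (-R) R) := by
  have aux : ∀ (s : Set ℝ) (c : ℝ), s ⊆ Ioo (-δ) δ → MeasurableSet s → volume s = ENNReal.ofReal R →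
      (∀ x ∈ s, c ≤ f x) → c * R ≤ P.real s := by
    intro s c hs hm hv hc
    -- Only the sum of the one-sided limits is bounded below, so one of the two lower bounds may be
    -- negative.
    rcases lt_or_ge c 0 with hc0 | hc0
    · exact (mul_nonpos_of_nonpos_of_nonneg hc0.le hR.le).trans measureReal_nonneg
    have : ENNReal.ofReal (c * R) ≤ P s := by
      rw [h.apply_eq hs hm, ENNReal.ofReal_mul hc0, ← hv, ← setLIntegral_const]
      exact setLIntegral_mono (by have := h.measurable; fun_prop)
        fun x hx => ENNReal.ofReal_le_ofReal (hc x hx)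
    exact (ENNReal.ofReal_le_iff_le_toReal (measure_ne_top _ _)).1 this
  have h1 := aux (Ioo 0 R) (fp - C * R) (Ioo_subset_Ioo (by linarith) hRδ) measurableSet_Ioo
    (by simp) (fun x hx => by
      have := h.lipschitz_right x ⟨hx.1, hx.2.trans_le hRδ⟩
      rw [abs_of_pos hx.1] at this
      have h2 := abs_le.1 this
      nlinarith [hx.2, h.const_pos])
  have h2 := aux (Ioo (-R) 0) (fm - C * R) (Ioo_subset_Ioo (by linarith) (by linarith))
    measurableSet_Ioo (by simp) (fun x hx => by
      have := h.lipschitz_left x ⟨by linarith [hx.1], hx.2⟩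
      rw [abs_of_neg hx.2] at this
      have h2 := abs_le.1 this
      nlinarith [hx.1, h.const_pos])
  have h3 : P.real (Ioo (-R) 0) + P.real (Ioo 0 R) ≤ P.real (Ioo (-R) R) := by
    rw [← measureReal_union _ measurableSet_Ioo]
    · refine measureReal_mono (union_subset (Ioo_subset_Ioo le_rfl hR.le)
        (Ioo_subset_Ioo (by linarith) le_rfl))
    · exact Set.disjoint_left.2 fun x hx hx' => (hx.2.trans hx'.1).false
  nlinarith

/-- Against an even bounded function supported in `[-R, R]`, the centred sign has expectation of
order `R ^ 2`. -/
lemma norm_integral_even_mul_le (h : HasLipschitzDensity P f δ C fm fp)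
    (hpos : 0 < fm + fp) {R : ℝ} (hR : 0 < R) (hRδ : R ≤ δ) {g : ℝ → ℂ}
    (heven : ∀ x, g (-x) = g x) (hbdd : ∀ x, ‖g x‖ ≤ 1)
    (hgm : Measurable g) (hsupp : ∀ x, R ≤ |x| → g x = 0) :
    ‖∫ x, g x * ((if 0 ≤ x then 1 else 0) - (piF fm fp : ℂ)) ∂P‖ ≤ 2 * C * R ^ 2 := by
  set p := piF fm fp with hp
  have hp01 : p ∈ Icc (0 : ℝ) 1 := h.piF_mem_Icc hpos
  have hp0 := hp01.1
  have hp1 := hp01.2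
  -- This balance characterizes `piF`: the piecewise constant density times the centred sign takes
  -- opposite values on the two sides of zero.
  have hc : fp * (1 - p) = fm * p := by
    rw [hp, piF]; field_simp; ring
  set H : ℝ → ℂ := fun x => g x * ((if 0 ≤ x then 1 else 0) - (p : ℂ)) with hH
  have hHs : ∀ x ∉ Ioo (-R) R, H x = 0 := by
    intro x hx
    have : R ≤ |x| := by
      by_contra hlt
      exact hx (abs_lt.1 (not_le.1 hlt))
    simp [hH, hsupp x this]
  have hsub : Ioo (-R) R ⊆ Ioo (-δ) δ := Ioo_subset_Ioo (by linarith) hRδ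
  have e1 : ∫ x, H x ∂P = ∫ x in Ioo (-R) R, f x • H x := by
    rw [← setIntegral_eq_integral_of_forall_compl_eq_zero (s := Ioo (-δ) δ)
      fun x hx => hHs x fun hx' => hx (hsub hx'), h.restrict_eq,
      integral_withDensity_eq_integral_toReal_smul (by have := h.measurable; fun_prop) (by simp)]
    rw [← setIntegral_eq_of_subset_of_forall_sdiff_eq_zero measurableSet_Ioo hsub]
    · refine setIntegral_congr_fun measurableSet_Ioo fun x hx => ?_
      rw [ENNReal.toReal_ofReal (h.nonneg x hx)]
    · intro x hx
      simp [hHs x hx.2]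
  -- the odd part of the integrand
  set c : ℝ := fp * (1 - p) with hcdef
  clear_value p
  set O : ℝ → ℂ := fun x => (c * SignType.sign x : ℝ) * g x with hO
  have hOm : Measurable O := by
    have : Measurable fun x : ℝ => (SignType.sign x : ℝ) := by
      have : (fun x : ℝ => ((SignType.sign x : SignType) : ℝ)) =
          fun x => if 0 < x then 1 else if x < 0 then -1 else 0 := by
        ext x
        simp only [sign_apply]
        split_ifs <;> simp
      rw [this]
      exact Measurable.ite measurableSet_Ioi measurable_const
        (Measurable.ite measurableSet_Iio measurable_const measurable_const)
    fun_prop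
  have hO0 : ∫ x in Ioo (-R) R, O x = 0 := by
    have hs : ∀ x ∉ Ioo (-R) R, O x = 0 := by
      intro x hx
      have : R ≤ |x| := by
        by_contra hlt
        exact hx (abs_lt.1 (not_le.1 hlt))
      simp [hO, hsupp x this]
    rw [setIntegral_eq_integral_of_forall_compl_eq_zero hs]
    have h1 : ∫ x, O (-x) = ∫ x, O x := integral_neg_eq_self O volume
    have h2 : ∫ x, O (-x) = - ∫ x, O x := by
      rw [← integral_neg]
      congr 1
      ext x
      simp [hO, heven, Left.sign_neg]
    rw [h1] at h2
    exact self_eq_neg.1 h2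
  have hfin : volume (Ioo (-R) R) < ⊤ := by simp
  have hfm := h.measurable
  have hHm : Measurable H := by
    refine hgm.mul ((Measurable.ite measurableSet_Ici measurable_const measurable_const).sub
      measurable_const)
  -- Off the odd part only the deviation of `f` from its one-sided limit remains; the window length
  -- `2 * R` supplies the second power of `R`. The origin is excluded since neither Lipschitz bound
  -- controls `f 0`.
  have bound : ∀ x ∈ Ioo (-R) R, x ≠ 0 → ‖f x • H x - O x‖ ≤ C * R := by
    intro x hx hx0
    have hCR : 0 ≤ C * R := mul_nonneg h.const_pos.le hR.le
    rcases lt_or_gt_of_ne hx0 with hneg | hpos'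
    · have hL := h.lipschitz_left x ⟨by linarith [hx.1], hneg⟩
      have e : f x • H x - O x = ((fm - f x) * p : ℝ) * g x := by
        have : ¬ 0 ≤ x := not_le.2 hneg
        simp only [hH, hO, this, if_false, sign_neg hneg, hc, Complex.real_smul]
        push_cast
        simp
        ring
      rw [e, norm_mul, Complex.norm_real, Real.norm_eq_abs, abs_mul, abs_sub_comm,
        abs_of_nonneg hp01.1]
      have : |f x - fm| ≤ C * R := hL.trans (mul_le_mul_of_nonneg_left
        (by rw [abs_of_neg hneg]; linarith [hx.1]) h.const_pos.le)
      calc _ ≤ (C * R) * 1 * 1 := by gcongr; exact hbdd x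
        _ = _ := by ring
    · have hL := h.lipschitz_right x ⟨hpos', by linarith [hx.2]⟩
      have e : f x • H x - O x = ((f x - fp) * (1 - p) : ℝ) * g x := by
        simp only [hH, hO, hpos'.le, if_true, sign_pos hpos', hcdef, Complex.real_smul]
        push_cast
        simp
        ring
      rw [e, norm_mul, Complex.norm_real, Real.norm_eq_abs, abs_mul,
        abs_of_nonneg (sub_nonneg.2 hp01.2)]
      have : |f x - fp| ≤ C * R := hL.trans (mul_le_mul_of_nonneg_left
        (by rw [abs_of_pos hpos']; linarith [hx.2]) h.const_pos.le)
      calc _ ≤ (C * R) * 1 * 1 := by gcongr; exacts [by linarith, hbdd x]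
        _ = _ := by ring
  have hne : ∀ᵐ x : ℝ, x ≠ 0 := by
    simp [ae_iff]
  have hOb : ∀ x, ‖O x‖ ≤ |c| := by
    intro x
    simp only [hO]
    rw [norm_mul, Complex.norm_real, Real.norm_eq_abs, abs_mul]
    have : |(SignType.sign x : ℝ)| ≤ 1 := by
      rcases lt_trichotomy x 0 with h | rfl | h
      · simp [sign_neg h]
      · simp
      · simp [sign_pos h]
    calc _ ≤ |c| * 1 * 1 := by gcongr; exact hbdd x
      _ = _ := by ring
  have hOi : IntegrableOn O (Ioo (-R) R) :=
    Measure.integrableOn_of_bounded hfin.ne hOm.aestronglyMeasurable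
      (Eventually.of_forall hOb)
  have hDi : IntegrableOn (fun x => f x • H x - O x) (Ioo (-R) R) := by
    refine Measure.integrableOn_of_bounded (M := C * R) hfin.ne
      (((hfm.smul hHm).sub hOm).aestronglyMeasurable) ?_
    filter_upwards [ae_restrict_of_ae hne, ae_restrict_mem measurableSet_Ioo] with x h0 hx
      using bound x hx h0
  have e2 : ∫ x in Ioo (-R) R, f x • H x = ∫ x in Ioo (-R) R, (f x • H x - O x) := by
    have : (fun x => f x • H x) = fun x => (f x • H x - O x) + O x := by ext; simp
    conv_lhs => rw [this]
    rw [integral_add hDi hOi, hO0, add_zero]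
  rw [e1, e2]
  refine (norm_setIntegral_le_of_norm_le_const_ae' (C := C * R) hfin ?_).trans_eq ?_
  · filter_upwards [hne] with x h0 hx using bound x hx h0
  · rw [Real.volume_real_Ioo_of_le (by linarith)]
    ring

end HasLipschitzDensity

/-! ### Replacing signs by their means -/

lemma measurable_card_filter {α ι : Type*} [MeasurableSpace α] [Fintype ι] {p : ι → α → Prop}
    [∀ a, DecidablePred fun i => p i a] (hp : ∀ i, MeasurableSet {a | p i a}) :
    Measurable fun a => Finset.card {i | p i a} := by
  classical
  have : (fun a => Finset.card {i | p i a}) =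
      fun a => ∑ i, {a | p i a}.indicator (fun _ => 1) a := by
    ext a
    rw [Finset.card_filter]
    refine Finset.sum_congr rfl fun i _ => ?_
    by_cases h : p i a <;> simp [h]
  rw [this]
  exact Finset.measurable_sum _ fun i _ => measurable_const.indicator (hp i)

lemma measurableSet_mem_nearSet {n : ℕ} (q : ℕ) (R : ℝ) (i : Fin n) :
    MeasurableSet {z : Fin n → ℝ | i ∈ nearSet q R z} := by
  have h1 : MeasurableSet {z : Fin n → ℝ | |z i| < R} :=
    measurableSet_lt (by fun_prop) measurable_const
  have h2 : MeasurableSet {z : Fin n → ℝ | Finset.card {k : Fin n | |z k| < |z i|} < q} :=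
    measurableSet_lt (measurable_card_filter fun k => measurableSet_lt (by fun_prop) (by fun_prop))
      measurable_const
  convert h1.inter h2 using 1
  ext z
  simp [nearSet]

/-- The factor contributed by the `i`-th observation to `w ^ s`, for `s` the sign statistic. -/
noncomputable def signFactor {n : ℕ} (q : ℕ) (R : ℝ) (w : ℂ) (z : Fin n → ℝ) (i : Fin n) : ℂ :=
  if i ∈ nearSet q R z then if 0 ≤ z i then w else 1 else 1

/-- The mean of `signFactor` when the signs are independent of the absolute values. -/
noncomputable def meanFactor {n : ℕ} (q : ℕ) (R : ℝ) (β : ℂ) (z : Fin n → ℝ) (i : Fin n) : ℂ :=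
  if i ∈ nearSet q R z then β else 1

lemma prod_signFactor {n : ℕ} (q : ℕ) (R : ℝ) (w : ℂ) (z : Fin n → ℝ) :
    ∏ i, signFactor q R w z i = w ^ Finset.card {i ∈ nearSet q R z | 0 ≤ z i} := by
  simp only [signFactor]
  rw [Finset.prod_ite_mem, Finset.univ_inter, ← Finset.prod_filter, Finset.prod_const]

lemma prod_meanFactor {n : ℕ} (q : ℕ) (R : ℝ) (β : ℂ) (z : Fin n → ℝ) :
    ∏ i, meanFactor q R β z i = β ^ (nearSet q R z).card := by
  simp only [meanFactor]
  rw [Finset.prod_ite_mem, Finset.univ_inter, Finset.prod_const]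

lemma measurable_signFactor {n : ℕ} (q : ℕ) (R : ℝ) (w : ℂ) (i : Fin n) :
    Measurable fun z : Fin n → ℝ => signFactor q R w z i :=
  Measurable.ite (measurableSet_mem_nearSet q R i)
    (Measurable.ite (measurableSet_le measurable_const (by fun_prop)) measurable_const
      measurable_const) measurable_const

lemma measurable_meanFactor {n : ℕ} (q : ℕ) (R : ℝ) (β : ℂ) (i : Fin n) :
    Measurable fun z : Fin n → ℝ => meanFactor q R β z i :=
  Measurable.ite (measurableSet_mem_nearSet q R i) measurable_const measurable_const

lemma norm_signFactor_le {n : ℕ} {q : ℕ} {R : ℝ} {w : ℂ} (hw : ‖w‖ ≤ 1) (z : Fin n → ℝ)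
    (i : Fin n) : ‖signFactor q R w z i‖ ≤ 1 := by
  unfold signFactor
  split_ifs <;> simp [hw]

lemma norm_meanFactor_le {n : ℕ} {q : ℕ} {R : ℝ} {β : ℂ} (hβ : ‖β‖ ≤ 1) (z : Fin n → ℝ)
    (i : Fin n) : ‖meanFactor q R β z i‖ ≤ 1 := by
  unfold meanFactor
  split_ifs <;> simp [hβ]

lemma norm_prod_le_one {ι : Type*} (s : Finset ι) {a : ι → ℂ} (h : ∀ i ∈ s, ‖a i‖ ≤ 1) :
    ‖∏ i ∈ s, a i‖ ≤ 1 := by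
  rw [norm_prod]
  exact Finset.prod_le_one (fun _ _ => norm_nonneg _) h

/-- Fubini: the `k`-th coordinate is integrated first, with the others frozen. -/
lemma norm_integral_pi_le {m : ℕ} {P : Measure ℝ} [IsProbabilityMeasure P] (k : Fin (m + 1))
    {F : (Fin (m + 1) → ℝ) → ℂ} {ε : ℝ} (hF : Integrable F (Measure.pi fun _ => P))
    (h : ∀ y : Fin m → ℝ, ‖∫ x, F (k.insertNth x y) ∂P‖ ≤ ε) :
    ‖∫ z, F z ∂(Measure.pi fun _ => P)‖ ≤ ε := by
  have mp := (measurePreserving_piFinSuccAbove (fun _ : Fin (m + 1) => P) k).symm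
  rw [← mp.integrable_comp_emb (MeasurableEquiv.measurableEmbedding _)] at hF
  rw [← mp.integral_comp', integral_prod_symm _ (by exact hF)]
  have := norm_integral_le_of_norm_le_const (μ := Measure.pi fun _ : Fin m => P)
    (Eventually.of_forall h)
  rwa [probReal_univ, mul_one] at this

/-- The hybrid of the two products in which the factors with index below `k` are replaced by
their means. -/
noncomputable def hybridFactor {n : ℕ} (q : ℕ) (R : ℝ) (w β : ℂ) (k : ℕ) (z : Fin n → ℝ)
    (i : Fin n) : ℂ :=
  if i.val < k then meanFactor q R β z i else signFactor q R w z i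

lemma measurable_hybridFactor {n : ℕ} (q : ℕ) (R : ℝ) (w β : ℂ) (k : ℕ) (i : Fin n) :
    Measurable fun z : Fin n → ℝ => hybridFactor q R w β k z i := by
  unfold hybridFactor
  split_ifs
  · exact measurable_meanFactor q R β i
  · exact measurable_signFactor q R w i

lemma norm_hybridFactor_le {n : ℕ} {q : ℕ} {R : ℝ} {w β : ℂ} (hw : ‖w‖ ≤ 1) (hβ : ‖β‖ ≤ 1)
    (k : ℕ) (z : Fin n → ℝ) (i : Fin n) : ‖hybridFactor q R w β k z i‖ ≤ 1 := by
  unfold hybridFactor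
  split_ifs
  · exact norm_meanFactor_le hβ z i
  · exact norm_signFactor_le hw z i

lemma integrable_prod_hybridFactor {n : ℕ} {P : Measure ℝ} [IsProbabilityMeasure P] {q : ℕ}
    {R : ℝ} {w β : ℂ} (hw : ‖w‖ ≤ 1) (hβ : ‖β‖ ≤ 1) (k : ℕ) (s : Finset (Fin n)) :
    Integrable (fun z => ∏ i ∈ s, hybridFactor q R w β k z i)
      (Measure.pi fun _ : Fin n => P) :=
  Integrable.of_bound (Finset.measurable_fun_prod _ fun i _ =>
    measurable_hybridFactor q R w β k i).aestronglyMeasurable 1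
    (Eventually.of_forall fun z => norm_prod_le_one _ fun i _ => norm_hybridFactor_le hw hβ k z i)

/-- Consecutive hybrids differ in the factor of index `k` alone. If `k` is not selected both
versions equal 1; otherwise their difference is `w - 1` times the centred sign. -/
lemma prod_hybridFactor_sub {n : ℕ} (q : ℕ) (R p : ℝ) (w : ℂ) (k : Fin n) (z : Fin n → ℝ) :
    (∏ i, hybridFactor q R w (1 + p * (w - 1)) k z i) -
        ∏ i, hybridFactor q R w (1 + p * (w - 1)) (k + 1) z i =
      (w - 1) * ((if k ∈ nearSet q R z then
        ∏ i ∈ Finset.univ.erase k, hybridFactor q R w (1 + p * (w - 1)) k z i else 0) *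
          ((if 0 ≤ z k then 1 else 0) - (p : ℂ))) := by
  have e : ∏ i ∈ Finset.univ.erase k, hybridFactor q R w (1 + p * (w - 1)) (k + 1) z i =
      ∏ i ∈ Finset.univ.erase k, hybridFactor q R w (1 + p * (w - 1)) k z i := by
    refine Finset.prod_congr rfl fun i hi => ?_
    have : i.val ≠ k.val := fun h => (Finset.ne_of_mem_erase hi) (Fin.ext h)
    simp only [hybridFactor]
    congr 1
    simp only [eq_iff_iff]
    omega
  rw [← Finset.mul_prod_erase _ _ (Finset.mem_univ k),
    ← Finset.mul_prod_erase _ (hybridFactor q R w (1 + p * (w - 1)) (k + 1) z)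
      (Finset.mem_univ k), e, ← sub_mul]
  simp only [hybridFactor, lt_irrefl, if_false, Nat.lt_succ_self, if_true, signFactor, meanFactor]
  split_ifs <;> ring

/-- As a function of the `k`-th coordinate, the product of the other factors is even: it sees that
coordinate only through the selection. It is cut off at `R` because a selected observation lies in
the window, so `norm_integral_even_mul_le` applies. -/
lemma norm_integral_prod_hybridFactor_sub_le {n : ℕ} {P : Measure ℝ} [IsProbabilityMeasure P]
    {f : ℝ → ℝ} {δ C fm fp : ℝ} (h : HasLipschitzDensity P f δ C fm fp) (hpos : 0 < fm + fp)
    {q : ℕ} {R : ℝ} (hR : 0 < R) (hRδ : R ≤ δ) {w : ℂ} (hw : ‖w‖ ≤ 1)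
    (hβ : ‖1 + piF fm fp * (w - 1)‖ ≤ 1) (k : Fin n) :
    ‖∫ z, ((∏ i, hybridFactor q R w (1 + piF fm fp * (w - 1)) k z i) -
        ∏ i, hybridFactor q R w (1 + piF fm fp * (w - 1)) (k + 1) z i)
          ∂(Measure.pi fun _ : Fin n => P)‖ ≤ ‖w - 1‖ * (2 * C * R ^ 2) := by
  obtain ⟨m, rfl⟩ : ∃ m, n = m + 1 := ⟨n - 1, by have := k.2; omega⟩
  refine norm_integral_pi_le k ((integrable_prod_hybridFactor hw hβ _ _).sub
    (integrable_prod_hybridFactor hw hβ _ _)) fun y => ?_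
  simp_rw [prod_hybridFactor_sub]
  rw [integral_const_mul, norm_mul]
  refine mul_le_mul_of_nonneg_left ?_ (norm_nonneg _)
  set g : ℝ → ℂ := fun x => if k ∈ nearSet q R (k.insertNth x y) then
    ∏ i ∈ Finset.univ.erase k, hybridFactor q R w (1 + piF fm fp * (w - 1)) k (k.insertNth x y) i
    else 0 with hg
  have hins : Measurable fun x : ℝ => (k.insertNth x y : Fin (m + 1) → ℝ) := by
    refine measurable_pi_lambda _ fun i => ?_
    refine Fin.succAboveCases k ?_ (fun j => ?_) i
    · simpa using measurable_id'
    · simp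
  have key := h.norm_integral_even_mul_le hpos hR hRδ (g := g) ?_ ?_ ?_ ?_
  · simpa [hg] using key
  · intro x
    have hn : nearSet q R (k.insertNth (-x) y : Fin (m + 1) → ℝ) =
        nearSet q R (k.insertNth x y : Fin (m + 1) → ℝ) := by
      refine nearSet_congr fun i => ?_
      refine Fin.succAboveCases k ?_ (fun j => ?_) i <;> simp
    simp only [hg]
    rw [hn]
    congr 1
    refine Finset.prod_congr rfl fun i hi => ?_
    obtain ⟨j, rfl⟩ := Fin.exists_succAbove_eq (Finset.ne_of_mem_erase hi)
    simp [hybridFactor, signFactor, meanFactor, hn]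
  · intro x
    simp only [hg]
    split_ifs
    · exact norm_prod_le_one _ fun i _ => norm_hybridFactor_le hw hβ _ _ i
    · simp
  · exact Measurable.ite (hins (measurableSet_mem_nearSet q R k))
      ((Finset.measurable_fun_prod _ fun i _ => measurable_hybridFactor q R w _ _ i).comp hins)
      measurable_const
  · intro x hx
    simp [hg, nearSet, not_lt.2 hx]

lemma norm_integral_prod_signFactor_sub_le {n : ℕ} {P : Measure ℝ} [IsProbabilityMeasure P]
    {f : ℝ → ℝ} {δ C fm fp : ℝ} (h : HasLipschitzDensity P f δ C fm fp) (hpos : 0 < fm + fp)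
    {q : ℕ} {R : ℝ} (hR : 0 < R) (hRδ : R ≤ δ) {w : ℂ} (hw : ‖w‖ ≤ 1)
    (hβ : ‖1 + piF fm fp * (w - 1)‖ ≤ 1) :
    ‖∫ z, ∏ i, signFactor q R w z i ∂(Measure.pi fun _ : Fin n => P) -
      ∫ z, ∏ i, meanFactor q R (1 + piF fm fp * (w - 1)) z i ∂(Measure.pi fun _ : Fin n => P)‖ ≤
      n * (‖w - 1‖ * (2 * C * R ^ 2)) := by
  set J : ℕ → ℂ := fun k => ∫ z, ∏ i, hybridFactor q R w (1 + piF fm fp * (w - 1)) k z i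
    ∂(Measure.pi fun _ : Fin n => P) with hJ
  have e0 : ∫ z, ∏ i, signFactor q R w z i ∂(Measure.pi fun _ : Fin n => P) = J 0 := by
    simp [hJ, hybridFactor]
  have en : ∫ z, ∏ i, meanFactor q R (1 + piF fm fp * (w - 1)) z i
      ∂(Measure.pi fun _ : Fin n => P) = J n := by
    simp [hJ, hybridFactor]
  rw [e0, en, ← Finset.sum_range_sub', ← nsmul_eq_mul]
  refine (norm_sum_le _ _).trans ((Finset.sum_le_card_nsmul _ _ _ fun k hk => ?_).trans_eq
    (by rw [Finset.card_range]))
  have := norm_integral_prod_hybridFactor_sub_le (q := q) h hpos hR hRδ hw hβ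
    ⟨k, Finset.mem_range.1 hk⟩
  rwa [integral_sub (integrable_prod_hybridFactor hw hβ _ _)
    (integrable_prod_hybridFactor hw hβ _ _)] at this

/-! ### Exceptional events and the generating function of the sign statistic -/

/-- Exponential Markov inequality: if `N` counts the points in the window, then `2 ^ (q - N) ≥ 1` on
the event, and `2 ^ (-N)` is a product of independent factors of mean `1 - p / 2`. -/
lemma measureReal_card_lt_le {n : ℕ} (P : Measure ℝ) [IsProbabilityMeasure P] (q : ℕ) (R : ℝ) :
    (Measure.pi fun _ : Fin n => P).real {z | Finset.card {i : Fin n | |z i| < R} < q} ≤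
      2 ^ q * Real.exp (-(n * (P.real (Ioo (-R) R) / 2))) := by
  set p := P.real (Ioo (-R) R) with hp
  set φ : ℝ → ℝ := fun x => if |x| < R then 1 / 2 else 1 with hφ
  have hφm : Measurable φ :=
    Measurable.ite (measurableSet_lt (by fun_prop) measurable_const) measurable_const
      measurable_const
  have hφ1 : ∀ x, |φ x| ≤ 1 := by
    intro x; simp only [hφ]; split_ifs <;> norm_num [abs_of_pos]
  have hset : {x : ℝ | |x| < R} = Ioo (-R) R := by ext x; simp [abs_lt]
  have hφi : ∫ x, φ x ∂P = 1 - p / 2 := by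
    have : φ = fun x => 1 - (Ioo (-R) R).indicator (fun _ => (1 / 2 : ℝ)) x := by
      ext x
      simp only [hφ, indicator, ← hset, mem_ofPred_eq]
      split_ifs <;> norm_num
    rw [this, integral_sub (integrable_const _)
      ((integrable_const _).indicator measurableSet_Ioo), integral_indicator_const _
      measurableSet_Ioo]
    simp [← hp]
    ring
  set N : (Fin n → ℝ) → ℕ := fun z => Finset.card {i : Fin n | |z i| < R} with hN
  have hprod : ∀ z : Fin n → ℝ, ∏ i, φ (z i) = (1 / 2) ^ N z := by
    intro z
    simp only [hφ, hN]
    rw [← Finset.prod_filter, Finset.prod_const]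
  have hNm : Measurable N :=
    measurable_card_filter fun i => measurableSet_lt (by fun_prop) measurable_const
  have hE : MeasurableSet {z | N z < q} := measurableSet_lt hNm measurable_const
  have hint : Integrable (fun z : Fin n → ℝ => ∏ i, φ (z i)) (Measure.pi fun _ => P) :=
    Integrable.fintype_prod fun i => Integrable.of_bound hφm.aestronglyMeasurable 1
      (Eventually.of_forall hφ1)
  calc (Measure.pi fun _ : Fin n => P).real {z | N z < q}
      = ∫ z, {z | N z < q}.indicator (fun _ => (1 : ℝ)) z ∂(Measure.pi fun _ : Fin n => P) := by
        rw [integral_indicator_const _ hE]; simp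
    _ ≤ ∫ z, 2 ^ q * ∏ i, φ (z i) ∂(Measure.pi fun _ : Fin n => P) := by
        refine integral_mono ((integrable_const _).indicator hE) (hint.const_mul _) fun z => ?_
        simp only [hprod]
        by_cases hz : N z < q
        · rw [Set.indicator_of_mem (s := {z | N z < q}) hz]
          have h2 : (2 : ℝ) ^ N z * (1 / 2) ^ N z = 1 := by rw [← mul_pow]; norm_num
          exact h2.symm.le.trans (mul_le_mul_of_nonneg_right
            (pow_le_pow_right₀ one_le_two (le_of_lt hz)) (by positivity))
        · rw [Set.indicator_of_notMem (s := {z | N z < q}) hz]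
          positivity
    _ = 2 ^ q * (1 - p / 2) ^ n := by
        rw [integral_const_mul, integral_fintype_prod_eq_prod]
        simp [hφi]
    _ ≤ 2 ^ q * Real.exp (-(n * (p / 2))) := by
        have hp1 : p ≤ 1 := measureReal_le_one
        gcongr
        rw [← mul_neg, Real.exp_nat_mul]
        exact pow_le_pow_left₀ (by linarith) (by linarith [Real.add_one_le_exp (-(p / 2))]) n

/-- Given `X = x` in the window, a tie forces `Y` into `{x, -x}`, which carries no mass. -/
lemma measure_ties_eq_zero {Ω : Type*} [MeasurableSpace Ω] {μ : Measure Ω}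
    [IsProbabilityMeasure μ] {P : Measure ℝ} [IsProbabilityMeasure P] {R : ℝ}
    (hP : ∀ x, |x| < R → P {x} = 0) {X Y : Ω → ℝ} (hX : HasLaw X P μ) (hY : HasLaw Y P μ)
    (hXY : IndepFun X Y μ) : μ {ω | |X ω| < R ∧ |X ω| = |Y ω|} = 0 := by
  have hm := (indepFun_iff_map_prod_eq_prod_map_map hX.aemeasurable hY.aemeasurable).1 hXY
  rw [hX.map_eq, hY.map_eq] at hm
  have hs : MeasurableSet {x : ℝ × ℝ | |x.1| < R ∧ |x.1| = |x.2|} := by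
    have h1 : MeasurableSet {x : ℝ × ℝ | |x.1| < R} :=
      measurableSet_lt (by fun_prop) measurable_const
    have h2 : MeasurableSet {x : ℝ × ℝ | |x.1| = |x.2|} :=
      measurableSet_eq_fun (by fun_prop) (by fun_prop)
    exact h1.inter h2
  have := Measure.map_apply_of_aemeasurable (hX.aemeasurable.prodMk hY.aemeasurable) hs
  change μ ((fun ω => (X ω, Y ω)) ⁻¹' {x : ℝ × ℝ | |x.1| < R ∧ |x.1| = |x.2|}) = 0
  rw [← this, hm, Measure.measure_prod_null hs]
  refine Eventually.of_forall fun x => ?_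
  by_cases hx : |x| < R
  · refine measure_mono_null (t := {x} ∪ {-x}) ?_
      (measure_union_null (hP x hx) (hP (-x) (by rwa [abs_neg])))
    rintro y ⟨-, hy⟩
    have hy' : |y| = |x| := hy.symm
    rcases abs_eq_abs.1 hy' with h | h <;> simp [h]
  · simp [hx]

lemma norm_integral_sub_le_two_mul {Ω : Type*} [MeasurableSpace Ω] {μ : Measure Ω}
    [IsProbabilityMeasure μ] {a b : Ω → ℂ} (ha : ∀ ω, ‖a ω‖ ≤ 1) (hb : ∀ ω, ‖b ω‖ ≤ 1)
    (ham : AEStronglyMeasurable a μ) (hbm : AEStronglyMeasurable b μ) {E : Set Ω}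
    (hE : NullMeasurableSet E μ) (hab : ∀ᵐ ω ∂μ, ω ∉ E → a ω = b ω) :
    ‖∫ ω, a ω ∂μ - ∫ ω, b ω ∂μ‖ ≤ 2 * μ.real E := by
  have hai := Integrable.of_bound ham 1 (Eventually.of_forall ha)
  have hbi := Integrable.of_bound hbm 1 (Eventually.of_forall hb)
  rw [← integral_sub hai hbi]
  have : ∫ ω, E.indicator (fun _ => (2 : ℝ)) ω ∂μ = 2 * μ.real E := by
    rw [integral_indicator₀ hE]
    simp [mul_comm]
  rw [← this]
  refine norm_integral_le_of_norm_le ((integrable_const _).indicator₀ hE) ?_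
  filter_upwards [hab] with ω h
  by_cases hω : ω ∈ E
  · rw [indicator_of_mem hω]
    linarith [norm_sub_le (a ω) (b ω), ha ω, hb ω]
  · simp [hω, h hω]

/-- The generating function of the sign statistic is close to that of a binomial distribution. -/
theorem norm_integral_pow_sub_le {Ω : Type*} [MeasurableSpace Ω] {μ : Measure Ω}
    [IsProbabilityMeasure μ] {n : ℕ} {P : Measure ℝ} [IsProbabilityMeasure P]
    {f : ℝ → ℝ} {δ C fm fp : ℝ} {q : ℕ} {Z : Fin n → Ω → ℝ} {S : Ω → ℕ} (hS : AEMeasurable S μ)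
    (hSZ : ∀ ω, IsSignStatistic q (fun i => Z i ω) (S ω)) (hZ : IsIIDSample μ P Z)
    (h : HasLipschitzDensity P f δ C fm fp) (hpos : 0 < fm + fp)
    {R : ℝ} (hR : 0 < R) (hRδ : R ≤ δ) {w : ℂ} (hw : ‖w‖ ≤ 1) :
    ‖∫ ω, w ^ S ω ∂μ - (1 + piF fm fp * (w - 1)) ^ q‖ ≤
      n * (‖w - 1‖ * (2 * C * R ^ 2)) +
        4 * (2 ^ q * Real.exp (-(n * (P.real (Ioo (-R) R) / 2)))) := by
  set β : ℂ := 1 + piF fm fp * (w - 1) with hβdef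
  have hβ : ‖β‖ ≤ 1 := by
    have h01 := h.piF_mem_Icc hpos
    have := norm_convexComb_le_one h01.1 h01.2 (a := 1) (b := w) (by simp) hw
    convert this using 2
    rw [hβdef]; ring
  set V : Ω → Fin n → ℝ := fun ω i => Z i ω with hV
  have hVm : AEMeasurable V μ := aemeasurable_pi_lambda _ fun i => (hZ.hasLaw i).aemeasurable
  have hmap : μ.map V = Measure.pi fun _ => P := by
    rw [hV, (iIndepFun_iff_map_fun_eq_pi_map fun i => (hZ.hasLaw i).aemeasurable).1 hZ.indep]
    congr 1
    ext1 i
    exact (hZ.hasLaw i).map_eq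
  have hNm : MeasurableSet {z : Fin n → ℝ | Finset.card {i : Fin n | |z i| < R} < q} :=
    measurableSet_lt (measurable_card_filter fun i => measurableSet_lt (by fun_prop)
      measurable_const) measurable_const
  set E : Set Ω := V ⁻¹' {z | Finset.card {i : Fin n | |z i| < R} < q} with hEdef
  have hEm : NullMeasurableSet E μ := hVm.nullMeasurable hNm
  have hEle : μ.real E ≤ 2 ^ q * Real.exp (-(n * (P.real (Ioo (-R) R) / 2))) := by
    have := measureReal_card_lt_le (n := n) P q R
    rwa [← hmap, map_measureReal_apply_of_aemeasurable hVm hNm] at this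
  have hties : ∀ᵐ ω ∂μ, ∀ i j, i ≠ j → |V ω i| < R → |V ω i| ≠ |V ω j| := by
    refine ae_all_iff.2 fun i => ae_all_iff.2 fun j => ?_
    by_cases hij : i = j
    · simp [hij]
    have := measure_ties_eq_zero (R := R) (fun x hx => h.measure_singleton (hx.trans_le hRδ))
      (hZ.hasLaw i) (hZ.hasLaw j) (hZ.indep.indepFun hij)
    filter_upwards [compl_mem_ae_iff.2 this] with ω hω _ h1 h2 using hω ⟨h1, h2⟩
  have hgood : ∀ᵐ ω ∂μ, ω ∉ E → (nearSet q R (V ω)).card = q ∧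
      S ω = Finset.card {i ∈ nearSet q R (V ω) | 0 ≤ V ω i} := by
    filter_upwards [hties] with ω hω hωE
    exact (hSZ ω).eq_card hω (not_lt.1 hωE)
  have hAm : Measurable fun z : Fin n → ℝ => ∏ i, signFactor q R w z i :=
    Finset.measurable_fun_prod _ fun i _ => measurable_signFactor q R w i
  have hBm : Measurable fun z : Fin n → ℝ => ∏ i, meanFactor q R β z i :=
    Finset.measurable_fun_prod _ fun i _ => measurable_meanFactor q R β i
  have hwm : AEStronglyMeasurable (fun ω => w ^ S ω) μ :=
    ((measurable_from_top (f := fun s : ℕ => w ^ s)).comp_aemeasurable hS).aestronglyMeasurable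
  -- The exceptional event is paid for twice, on passing from `w ^ S` to the product and from the
  -- mean product to `β ^ q`; hence the factor 4.
  have s1 : ‖∫ ω, w ^ S ω ∂μ - ∫ ω, ∏ i, signFactor q R w (V ω) i ∂μ‖ ≤ 2 * μ.real E := by
    refine norm_integral_sub_le_two_mul (fun ω => ?_)
      (fun ω => norm_prod_le_one _ fun i _ => norm_signFactor_le hw _ i)
      hwm (hAm.comp_aemeasurable hVm).aestronglyMeasurable hEm ?_
    · rw [norm_pow]; exact pow_le_one₀ (norm_nonneg _) hw
    · filter_upwards [hgood] with ω hω hωE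
      rw [prod_signFactor, ← (hω hωE).2]
  have s3 : ‖∫ ω, ∏ i, meanFactor q R β (V ω) i ∂μ - ∫ _, β ^ q ∂μ‖ ≤ 2 * μ.real E := by
    refine norm_integral_sub_le_two_mul
      (fun ω => norm_prod_le_one _ fun i _ => norm_meanFactor_le hβ _ i) (fun ω => ?_)
      (hBm.comp_aemeasurable hVm).aestronglyMeasurable aestronglyMeasurable_const hEm ?_
    · rw [norm_pow]; exact pow_le_one₀ (norm_nonneg _) hβ
    · filter_upwards [hgood] with ω hω hωE
      rw [prod_meanFactor, (hω hωE).1]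
  have s2 := norm_integral_prod_signFactor_sub_le (n := n) (q := q) h hpos hR hRδ hw hβ
  rw [← hmap, integral_map hVm hAm.aestronglyMeasurable, integral_map hVm
    hBm.aestronglyMeasurable] at s2
  rw [integral_const, probReal_univ, one_smul] at s3
  calc _ = ‖(∫ ω, w ^ S ω ∂μ - ∫ ω, ∏ i, signFactor q R w (V ω) i ∂μ) +
        (∫ ω, ∏ i, signFactor q R w (V ω) i ∂μ - ∫ ω, ∏ i, meanFactor q R β (V ω) i ∂μ) +
        (∫ ω, ∏ i, meanFactor q R β (V ω) i ∂μ - β ^ q)‖ := by congr 1; ring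
    _ ≤ _ := (norm_add₃_le).trans (by linarith)

/-! ### The central limit theorem -/

/-- A central limit theorem for integer variables whose characteristic functions are close to
those of binomial variables. -/
theorem tendstoInDistribution_of_charFun_sub_tendsto {Ω : ℕ → Type*}
    [∀ n, MeasurableSpace (Ω n)] {μ : ∀ n, Measure (Ω n)} [∀ n, IsProbabilityMeasure (μ n)]
    {q : ℕ → ℕ} (hq : Tendsto q atTop atTop) {S : ∀ n, Ω n → ℕ}
    (hS : ∀ n, AEMeasurable (S n) (μ n)) {p : ℕ → ℝ} (hp : ∀ n, p n ∈ Icc (0 : ℝ) 1) {v : ℝ}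
    (hv : Tendsto (fun n => p n * (1 - p n)) atTop (𝓝 v)) {d : ℕ → ℝ} {D : ℝ}
    (hd : Tendsto d atTop (𝓝 D))
    (h : ∀ t : ℝ, Tendsto (fun n =>
      ∫ ω, Complex.exp ((t / √(q n : ℝ) : ℝ) * Complex.I) ^ S n ω ∂(μ n) -
        (1 + p n * (Complex.exp ((t / √(q n : ℝ) : ℝ) * Complex.I) - 1)) ^ q n) atTop (𝓝 0)) :
    TendstoInDistribution (fun n ω => √(q n : ℝ) * (1 / (q n : ℝ) * (S n ω : ℝ) - p n) + d n)
      atTop (id : ℝ → ℝ) μ (gaussianReal D v.toNNReal) := by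
  have hm : ∀ n, AEMeasurable
      (fun ω => √(q n : ℝ) * (1 / (q n : ℝ) * (S n ω : ℝ) - p n) + d n) (μ n) := fun n =>
    (measurable_from_top (f := fun s : ℕ =>
      √(q n : ℝ) * (1 / (q n : ℝ) * (s : ℝ) - p n) + d n)).comp_aemeasurable (hS n)
  have hv0 : 0 ≤ v := ge_of_tendsto' hv fun n => mul_nonneg (hp n).1 (sub_nonneg.2 (hp n).2)
  refine ⟨hm, aemeasurable_id, ProbabilityMeasure.tendsto_of_tendsto_charFun fun t => ?_⟩
  simp only [ProbabilityMeasure.coe_mk, Measure.map_id]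
  rw [charFun_gaussianReal]
  -- The phase produced by the centring and the drift `d n`. It has modulus one, so multiplying the
  -- error in `h` by it keeps the limit 0.
  set ph : ℕ → ℂ := fun n => Complex.exp ((t * d n - t * √(q n : ℝ) * p n : ℝ) * Complex.I)
    with hph
  have hcf : ∀ᶠ n in atTop, charFun ((μ n).map
      (fun ω => √(q n : ℝ) * (1 / (q n : ℝ) * (S n ω : ℝ) - p n) + d n)) t =
      ph n * (∫ ω, Complex.exp ((t / √(q n : ℝ) : ℝ) * Complex.I) ^ S n ω ∂(μ n) -
        (1 + p n * (Complex.exp ((t / √(q n : ℝ) : ℝ) * Complex.I) - 1)) ^ q n) +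
      Complex.exp ((t * d n : ℝ) * Complex.I) *
        centredBernoulliCharFun (p n) (t / √(q n : ℝ)) ^ q n := by
    filter_upwards [hq.eventually_gt_atTop 0] with n hn
    have hs : 0 < √(q n : ℝ) := Real.sqrt_pos.2 (Nat.cast_pos.2 hn)
    have hqs : (q n : ℝ) = √(q n : ℝ) * √(q n : ℝ) :=
      (Real.mul_self_sqrt (Nat.cast_nonneg _)).symm
    have e1 : charFun ((μ n).map
        (fun ω => √(q n : ℝ) * (1 / (q n : ℝ) * (S n ω : ℝ) - p n) + d n)) t =
        ph n * ∫ ω, Complex.exp ((t / √(q n : ℝ) : ℝ) * Complex.I) ^ S n ω ∂(μ n) := by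
      rw [charFun_apply_real, integral_map (hm n) (by fun_prop), ← integral_const_mul]
      congr 1
      ext ω
      rw [hph, ← Complex.exp_nat_mul, ← Complex.exp_add, ← Complex.ofReal_mul]
      congr 1
      rw [← mul_assoc, ← add_mul]
      congr 1
      rw [← Complex.ofReal_natCast, ← Complex.ofReal_mul, ← Complex.ofReal_add]
      congr 1
      rw [hqs, Real.sqrt_mul_self hs.le]
      field_simp
      ring
    have e2 : ph n * (1 + p n * (Complex.exp ((t / √(q n : ℝ) : ℝ) * Complex.I) - 1)) ^ q n =
        Complex.exp ((t * d n : ℝ) * Complex.I) *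
          centredBernoulliCharFun (p n) (t / √(q n : ℝ)) ^ q n := by
      set s := t / √(q n : ℝ) with hsdef
      have e3 : centredBernoulliCharFun (p n) s = Complex.exp ((-(s * p n) : ℝ) * Complex.I) *
          (1 + p n * (Complex.exp ((s : ℝ) * Complex.I) - 1)) := by
        have : Complex.exp ((s * (1 - p n) : ℝ) * Complex.I) =
            Complex.exp ((-(s * p n) : ℝ) * Complex.I) * Complex.exp ((s : ℝ) * Complex.I) := by
          rw [← Complex.exp_add]
          congr 1
          push_cast
          ring
        rw [centredBernoulliCharFun, this]
        ring
      rw [e3, mul_pow, ← mul_assoc, ← Complex.exp_nat_mul, ← Complex.exp_add]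
      congr 2
      rw [← Complex.ofReal_natCast, ← mul_assoc, ← Complex.ofReal_mul, ← add_mul,
        ← Complex.ofReal_add]
      simp only [hph]
      congr 3
      have : (q n : ℝ) * s = t * √(q n : ℝ) := by
        calc (q n : ℝ) * s = √(q n : ℝ) * √(q n : ℝ) * (t / √(q n : ℝ)) := by rw [← hqs]
          _ = _ := by field_simp
      linear_combination p n * this
    rw [e1, mul_sub, e2]
    ring
  have hlim : Tendsto (fun n => ph n *
      (∫ ω, Complex.exp ((t / √(q n : ℝ) : ℝ) * Complex.I) ^ S n ω ∂(μ n) -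
        (1 + p n * (Complex.exp ((t / √(q n : ℝ) : ℝ) * Complex.I) - 1)) ^ q n)) atTop (𝓝 0) := by
    refine squeeze_zero_norm (fun n => ?_) (tendsto_zero_iff_norm_tendsto_zero.1 (h t))
    rw [norm_mul, Complex.norm_exp_ofReal_mul_I, one_mul]
  have hd' : Tendsto (fun n => Complex.exp ((t * d n : ℝ) * Complex.I)) atTop
      (𝓝 (Complex.exp ((t * D : ℝ) * Complex.I))) := by
    have hc : Continuous fun x : ℝ => Complex.exp ((t * x : ℝ) * Complex.I) := by fun_prop
    exact (hc.tendsto D).comp hd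
  have := hlim.add (hd'.mul (tendsto_centredBernoulliCharFun_pow hq hp hv t))
  rw [zero_add, ← Complex.exp_add] at this
  refine (this.congr' (hcf.mono fun n hn => hn.symm)).trans_eq ?_
  congr 2
  rw [Real.coe_toNNReal v hv0]
  push_cast
  ring

open scoped unitInterval

lemma integral_pow_binomial (q : ℕ) (p : I) (w : ℂ) :
    ∫ k, w ^ k ∂(binomial q p) = (1 + ((p : ℝ) : ℂ) * (w - 1)) ^ q := by
  rw [integral_binomial]
  have : (1 + ((p : ℝ) : ℂ) * (w - 1)) = (p : ℝ) * w + (1 - (p : ℝ)) := by ring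
  rw [this, add_pow, Nat.range_succ_eq_Iic]
  refine Finset.sum_congr rfl fun k _ => ?_
  rw [Complex.real_smul]
  push_cast
  ring

/-- `1 / 2` as a point of the unit interval. -/
noncomputable def halfI : I := ⟨1 / 2, by norm_num, by norm_num⟩

/-- For an exact binomial law the error of the characteristic function is zero. The critical values
are binomial quantiles, so this limit governs them. -/
lemma tendstoInDistribution_binomial {q : ℕ → ℕ} (hq : Tendsto q atTop atTop) :
    TendstoInDistribution (fun n (k : ℕ) => √(q n : ℝ) * (1 / (q n : ℝ) * (k : ℝ) - 1 / 2))
      atTop (id : ℝ → ℝ) (fun n => binomial (q n) halfI) (gaussianReal 0 (1 / 4)) := by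
  have := tendstoInDistribution_of_charFun_sub_tendsto (μ := fun n => binomial (q n) halfI) hq
    (S := fun _ k => k) (fun _ => aemeasurable_id) (p := fun _ => 1 / 2) (v := 1 / 4)
    (fun _ => ⟨by norm_num, by norm_num⟩) (by norm_num) (d := fun _ => 0) tendsto_const_nhds
    (fun t => by simp [integral_pow_binomial, halfI])
  have e : (1 / 4 : ℝ).toNNReal = 1 / 4 := by
    ext; simp
  simpa only [add_zero, e] using this

lemma tendsto_div_of_tendsto_rpow_div {q : ℕ → ℕ} (hq : Tendsto q atTop atTop)
    (hrate : Tendsto (fun n : ℕ => (q n : ℝ) ^ (3 / 2 : ℝ) / (n : ℝ)) atTop (𝓝 0)) :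
    Tendsto (fun n : ℕ => (q n : ℝ) / (n : ℝ)) atTop (𝓝 0) := by
  refine squeeze_zero' (Eventually.of_forall fun n => by positivity) ?_ hrate
  filter_upwards [hq.eventually_ge_atTop 1] with n hn
  gcongr
  exact Real.self_le_rpow_of_one_le (Nat.one_le_cast.2 hn) (by norm_num)

lemma norm_exp_mul_I_sub_one_le (s : ℝ) : ‖Complex.exp (s * Complex.I) - 1‖ ≤ |s| := by
  rw [mul_comm]
  exact Real.norm_exp_I_mul_ofReal_sub_one_le

/-- The characteristic function of the sign statistic is asymptotically binomial. -/
theorem tendsto_integral_exp_pow_sub {Ω : ℕ → Type*} [∀ n, MeasurableSpace (Ω n)]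
    {μ : ∀ n, Measure (Ω n)} [∀ n, IsProbabilityMeasure (μ n)]
    {q : ℕ → ℕ} (hq : Tendsto q atTop atTop)
    (hrate : Tendsto (fun n : ℕ => (q n : ℝ) ^ (3 / 2 : ℝ) / (n : ℝ)) atTop (𝓝 0))
    {Z : ∀ n, Fin n → Ω n → ℝ} {S : ∀ n, Ω n → ℕ} (hS : ∀ n, AEMeasurable (S n) (μ n))
    (hSZ : ∀ n ω, IsSignStatistic (q n) (fun i => Z n i ω) (S n ω))
    {P : ℕ → Measure ℝ} [∀ n, IsProbabilityMeasure (P n)] {f : ℕ → ℝ → ℝ} {δ C κ : ℝ}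
    {fm fp : ℕ → ℝ} (hZ : ∀ n, IsIIDSample (μ n) (P n) (Z n))
    (h : ∀ n, HasLipschitzDensity (P n) (f n) δ C (fm n) (fp n)) (hκ : 0 < κ)
    (hκf : ∀ n, κ ≤ fm n + fp n) (t : ℝ) :
    Tendsto (fun n =>
      ∫ ω, Complex.exp ((t / √(q n : ℝ) : ℝ) * Complex.I) ^ S n ω ∂(μ n) -
        (1 + piF (fm n) (fp n) * (Complex.exp ((t / √(q n : ℝ) : ℝ) * Complex.I) - 1)) ^ q n)
      atTop (𝓝 0) := by
  -- The window then has mass at least `κ / 2 * R = 8 * q / n`, enough for the Chernoff exponent to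
  -- beat the prefactor `2 ^ q`.
  set R : ℕ → ℝ := fun n => 16 / κ * ((q n : ℝ) / n) with hRdef
  have hδ := (h 0).delta_pos
  have hC := (h 0).const_pos
  have hR0 : Tendsto R atTop (𝓝 0) := by
    simpa using (tendsto_div_of_tendsto_rpow_div hq hrate).const_mul (16 / κ)
  have hCR : Tendsto (fun n => 4 * C * R n) atTop (𝓝 0) := by
    simpa using hR0.const_mul (4 * C)
  have hexp : Tendsto (fun n => 4 * Real.exp (-(q n : ℝ))) atTop (𝓝 0) := by
    simpa using ((Real.tendsto_exp_neg_atTop_nhds_zero.comp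
      (tendsto_natCast_atTop_atTop.comp hq)).const_mul 4)
  have hb := (hrate.const_mul (|t| * (2 * C * (16 / κ) ^ 2))).add hexp
  rw [mul_zero, add_zero] at hb
  refine squeeze_zero_norm' ?_ hb
  filter_upwards [hq.eventually_ge_atTop 1, eventually_ge_atTop 1,
    hR0.eventually_le_const hδ, hCR.eventually_le_const hκ] with n hqn hn hRδ hCRn
  have hq0 : (0 : ℝ) < q n := Nat.cast_pos.2 hqn
  have hn0 : (0 : ℝ) < n := Nat.cast_pos.2 hn
  have hR : 0 < R n := by simp only [hRdef]; positivity
  have hs : 0 < √(q n : ℝ) := Real.sqrt_pos.2 hq0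
  have hmass := (h n).mul_le_measureReal hR hRδ (hκf n) hCRn
  refine (norm_integral_pow_sub_le (hS n) (hSZ n) (hZ n) (h n) (hκ.trans_le (hκf n)) hR hRδ
    (w := Complex.exp ((t / √(q n : ℝ) : ℝ) * Complex.I))
    (Complex.norm_exp_ofReal_mul_I _).le).trans (add_le_add ?_ ?_)
  · have h1 := norm_exp_mul_I_sub_one_le (t / √(q n : ℝ))
    calc _ ≤ n * (|t / √(q n : ℝ)| * (2 * C * R n ^ 2)) := by gcongr
      _ = |t| * (2 * C * (16 / κ) ^ 2) * ((q n : ℝ) ^ (3 / 2 : ℝ) / n) := by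
        have e : (q n : ℝ) ^ (3 / 2 : ℝ) = q n * √(q n : ℝ) := by
          rw [Real.sqrt_eq_rpow, show (3 / 2 : ℝ) = 1 + 1 / 2 by norm_num,
            Real.rpow_add hq0, Real.rpow_one]
        have e2 : (q n : ℝ) = √(q n : ℝ) * √(q n : ℝ) :=
          (Real.mul_self_sqrt (Nat.cast_nonneg _)).symm
        rw [e, abs_div, abs_of_pos hs]
        simp only [hRdef]
        generalize √(q n : ℝ) = r at *
        rw [e2]
        field_simp
  · gcongr
    have h2 : (2 : ℝ) ^ q n ≤ Real.exp (q n) := by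
      have : (2 : ℝ) ≤ Real.exp 1 := by linarith [Real.add_one_le_exp (1 : ℝ)]
      calc (2 : ℝ) ^ q n ≤ Real.exp 1 ^ q n := by gcongr
        _ = Real.exp (q n) := by rw [← Real.exp_nat_mul, mul_one]
    have h3 : 8 * (q n : ℝ) ≤ n * (P n).real (Ioo (-R n) (R n)) := by
      calc 8 * (q n : ℝ) = n * (κ / 2 * R n) := by simp only [hRdef]; field_simp; ring
        _ ≤ _ := by gcongr
    calc _ ≤ Real.exp (q n) * Real.exp (-(2 * q n)) := by
          exact mul_le_mul h2 (Real.exp_le_exp.2 (by linarith)) (Real.exp_pos _).le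
            (Real.exp_pos _).le
      _ = _ := by rw [← Real.exp_add]; congr 1; ring

/-! ### Distribution functions and the normal law -/

lemma continuous_cdf {ν : Measure ℝ} [IsProbabilityMeasure ν] (h0 : ∀ x, ν {x} = 0) :
    Continuous (cdf ν) := by
  rw [continuous_iff_continuousAt]
  intro y
  have hs := StieltjesFunction.measure_singleton (cdf ν) y
  rw [measure_cdf, h0 y, eq_comm, ENNReal.ofReal_eq_zero, sub_nonpos] at hs
  rw [(monotone_cdf _).continuousAt_iff_leftLim_eq_rightLim, StieltjesFunction.rightLim_eq]
  exact le_antisymm ((monotone_cdf _).leftLim_le le_rfl) hs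

/-- If `ν n` converges weakly to the atomless measure `ν`, its distribution functions converge
along convergent sequences of arguments. -/
lemma tendsto_of_Iio_le_of_le_Iic {ν : ℕ → ProbabilityMeasure ℝ} {ν₀ : ProbabilityMeasure ℝ}
    (hν : Tendsto ν atTop (𝓝 ν₀)) (h0 : ∀ x, (ν₀ : Measure ℝ) {x} = 0) {x : ℕ → ℝ} {x₀ : ℝ}
    (hx : Tendsto x atTop (𝓝 x₀)) {g : ℕ → ℝ}
    (hg₁ : ∀ᶠ n in atTop, (ν n : Measure ℝ).real (Iio (x n)) ≤ g n)
    (hg₂ : ∀ᶠ n in atTop, g n ≤ (ν n : Measure ℝ).real (Iic (x n))) :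
    Tendsto g atTop (𝓝 ((ν₀ : Measure ℝ).real (Iic x₀))) := by
  have hIic : ∀ y, Tendsto (fun n => (ν n : Measure ℝ).real (Iic y)) atTop
      (𝓝 ((ν₀ : Measure ℝ).real (Iic y))) := by
    intro y
    have := ProbabilityMeasure.tendsto_measure_of_null_frontier_of_tendsto' hν (E := Iic y)
      (by rw [frontier_Iic]; exact h0 y)
    exact (ENNReal.tendsto_toReal (measure_ne_top _ _)).comp this
  have hcont : Tendsto (fun y => (ν₀ : Measure ℝ).real (Iic y)) (𝓝 x₀)
      (𝓝 ((ν₀ : Measure ℝ).real (Iic x₀))) := by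
    have := (continuous_cdf h0).tendsto x₀
    rw [cdf_eq_real] at this
    exact this.congr fun y => cdf_eq_real _ y
  rw [tendsto_order]
  constructor
  · intro a ha
    -- A fixed `y` just below `x₀` absorbs the moving endpoint: eventually `Iic y ⊆ Iio (x n)`.
    obtain ⟨y, hy, hya⟩ : ∃ y, y < x₀ ∧ a < (ν₀ : Measure ℝ).real (Iic y) :=
      (Eventually.and (self_mem_nhdsWithin : ∀ᶠ y in 𝓝[<] x₀, y ∈ Iio x₀)
        ((hcont.eventually (lt_mem_nhds ha)).filter_mono nhdsWithin_le_nhds)).exists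
    filter_upwards [hg₁, (hIic y).eventually (lt_mem_nhds hya), hx.eventually (lt_mem_nhds hy)]
      with n h1 h2 h3
    exact h2.trans_le ((measureReal_mono (Iic_subset_Iio.2 h3)).trans h1)
  · intro a ha
    obtain ⟨y, hy, hya⟩ : ∃ y, x₀ < y ∧ (ν₀ : Measure ℝ).real (Iic y) < a :=
      (Eventually.and (self_mem_nhdsWithin : ∀ᶠ y in 𝓝[>] x₀, y ∈ Ioi x₀)
        ((hcont.eventually (gt_mem_nhds ha)).filter_mono nhdsWithin_le_nhds)).exists
    filter_upwards [hg₂, (hIic y).eventually (gt_mem_nhds hya), hx.eventually (gt_mem_nhds hy)]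
      with n h1 h2 h3
    exact (h1.trans (measureReal_mono (Iic_subset_Iic.2 h3.le))).trans_lt h2

lemma gaussianReal_singleton {m : ℝ} {v : NNReal} (hv : v ≠ 0) (x : ℝ) :
    gaussianReal m v {x} = 0 :=
  gaussianReal_absolutelyContinuous m hv (by simp)

lemma strictMono_cdf_gaussianReal : StrictMono (cdf (gaussianReal 0 1)) := by
  intro x y hxy
  have h : gaussianReal 0 1 (Ioc x y) ≠ 0 := by
    intro h
    have := gaussianReal_absolutelyContinuous' 0 one_ne_zero h
    rw [Real.volume_Ioc, ENNReal.ofReal_eq_zero] at this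
    linarith
  rw [← measure_cdf (gaussianReal 0 1), StieltjesFunction.measure_Ioc] at h
  have := ENNReal.ofReal_pos.1 (pos_iff_ne_zero.2 h)
  linarith

lemma cdf_gaussianReal_neg (x : ℝ) :
    cdf (gaussianReal 0 1) (-x) = 1 - cdf (gaussianReal 0 1) x := by
  have h1 : (gaussianReal 0 1).real (Iic (-x)) = (gaussianReal 0 1).real (Ici x) := by
    conv_lhs => rw [← neg_zero, ← gaussianReal_map_neg]
    rw [map_measureReal_apply measurable_neg measurableSet_Iic]
    congr 1
    ext y
    simp
  have h2 : (gaussianReal 0 1).real (Iio x) = (gaussianReal 0 1).real (Iic x) := by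
    have := nullSingletonClass_gaussianReal (μ := 0) (v := 1) one_ne_zero
    exact measureReal_congr Iio_ae_eq_Iic
  rw [cdf_eq_real, cdf_eq_real, h1, ← h2, ← compl_Iio, probReal_compl_eq_one_sub measurableSet_Iio]

lemma cdf_normalQuantile {p : ℝ} (hp : p ∈ Ioo (0 : ℝ) 1) :
    cdf (gaussianReal 0 1) (normalQuantile p) = p := by
  obtain ⟨x, hx⟩ : ∃ x, cdf (gaussianReal 0 1) x = p :=
    mem_range_of_exists_le_of_exists_ge
      (continuous_cdf (gaussianReal_singleton one_ne_zero))
      (((tendsto_cdf_atBot _).eventually (ge_mem_nhds hp.1)).exists)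
      (((tendsto_cdf_atTop _).eventually (le_mem_nhds hp.2)).exists)
  have : {y : ℝ | p ≤ cdf (gaussianReal 0 1) y} = Ici x := by
    ext y
    rw [← hx]
    exact strictMono_cdf_gaussianReal.le_iff_le
  rw [normalQuantile, this, csInf_Ici, hx]

lemma normalQuantile_pos {α : ℝ} (hα : α ∈ Ioo (0 : ℝ) 1) : 0 < normalQuantile (1 - α / 2) := by
  have h0 := cdf_gaussianReal_neg 0
  rw [neg_zero] at h0
  rw [← strictMono_cdf_gaussianReal.lt_iff_lt,
    cdf_normalQuantile ⟨by linarith [hα.2], by linarith [hα.1]⟩]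
  linarith [hα.2]

lemma cdf_neg_normalQuantile {α : ℝ} (hα : α ∈ Ioo (0 : ℝ) 1) :
    cdf (gaussianReal 0 1) (-normalQuantile (1 - α / 2)) = α / 2 := by
  rw [cdf_gaussianReal_neg, cdf_normalQuantile ⟨by linarith [hα.2], by linarith [hα.1]⟩]
  ring

/-- A fair sign indicator has variance `1 / 4`; rescaling by 2 is where the factor in `2 * Δ`
originates. -/
lemma gaussianReal_quarter_eq_map (m : ℝ) :
    gaussianReal m (1 / 4) = (gaussianReal 0 1).map fun x => 1 / 2 * x + m := by
  have : (fun x : ℝ => 1 / 2 * x + m) = (fun x => x + m) ∘ fun x => 1 / 2 * x := rfl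
  rw [this, ← Measure.map_map (by fun_prop) (by fun_prop), gaussianReal_map_const_mul,
    gaussianReal_map_add_const]
  congr 1
  · simp
  · ext; norm_num

lemma gaussianReal_quarter_real_Iic (y : ℝ) :
    (gaussianReal 0 (1 / 4)).real (Iic y) = cdf (gaussianReal 0 1) (2 * y) := by
  rw [gaussianReal_quarter_eq_map, map_measureReal_apply (by fun_prop) measurableSet_Iic,
    cdf_eq_real]
  congr 1
  ext x
  simp only [mem_preimage, mem_Iic, add_zero]
  constructor <;> intro h <;> linarith

lemma measureReal_abs_add_le {z : ℝ} (hz : 0 ≤ z) (d : ℝ) :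
    (gaussianReal 0 1).real {x | |x + d| ≤ z} =
      cdf (gaussianReal 0 1) (z - d) + cdf (gaussianReal 0 1) (z + d) - 1 := by
  have h1 : {x : ℝ | |x + d| ≤ z} = Icc (-z - d) (z - d) := by
    ext x
    rw [mem_ofPred_eq, abs_le, mem_Icc]
    constructor <;> rintro ⟨h, h'⟩ <;> constructor <;> linarith
  have := nullSingletonClass_gaussianReal (μ := 0) (v := 1) one_ne_zero
  rw [h1, ← measureReal_congr Ioc_ae_eq_Icc, measureReal_def]
  conv_lhs => rw [← measure_cdf (gaussianReal 0 1)]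
  rw [StieltjesFunction.measure_Ioc, ENNReal.toReal_ofReal
    (sub_nonneg.2 (monotone_cdf _ (by linarith))),
    show -z - d = -(z + d) by ring, cdf_gaussianReal_neg]
  ring

lemma cdf_gaussianReal_sub_cdf {a b : ℝ} (hab : a ≤ b) :
    cdf (gaussianReal 0 1) b - cdf (gaussianReal 0 1) a = ∫ x in a..b, gaussianPDFReal 0 1 x := by
  rw [intervalIntegral.integral_of_le hab]
  have h := gaussianReal_apply_eq_integral 0 one_ne_zero (Ioc a b)
  rw [← measure_cdf (gaussianReal 0 1), StieltjesFunction.measure_Ioc] at h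
  rwa [ENNReal.ofReal_eq_ofReal_iff (sub_nonneg.2 (monotone_cdf _ hab))
    (setIntegral_nonneg measurableSet_Ioc fun x _ => gaussianPDFReal_nonneg 0 1 x)] at h

lemma continuous_gaussianPDFReal : Continuous (gaussianPDFReal 0 1) := by
  rw [gaussianPDFReal_def]
  fun_prop

lemma gaussianPDFReal_lt {x y : ℝ} (h : |x| < |y|) :
    gaussianPDFReal 0 1 y < gaussianPDFReal 0 1 x := by
  simp only [gaussianPDFReal_def]
  have := sq_lt_sq.2 h
  refine mul_lt_mul_of_pos_left (Real.exp_lt_exp.2 ?_) (by positivity)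
  simp only [sub_zero, NNReal.coe_one, mul_one]
  linarith

/-- A shift of the acceptance interval gains the density at `z + u` and loses it at `z - u`, which
is nearer to zero and so larger. This makes the local power exceed the level. -/
lemma cdf_sub_add_cdf_add_lt_of_pos {z d : ℝ} (hz : 0 < z) (hd : 0 < d) :
    cdf (gaussianReal 0 1) (z - d) + cdf (gaussianReal 0 1) (z + d) <
      2 * cdf (gaussianReal 0 1) z := by
  have h1 := cdf_gaussianReal_sub_cdf (show z ≤ z + d by linarith)
  have h2 := cdf_gaussianReal_sub_cdf (show z - d ≤ z by linarith)
  have e1 : ∫ u in (0 : ℝ)..d, gaussianPDFReal 0 1 (z + u) =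
      ∫ x in z..z + d, gaussianPDFReal 0 1 x := by
    rw [intervalIntegral.integral_comp_add_left, add_zero]
  have e2 : ∫ u in (0 : ℝ)..d, gaussianPDFReal 0 1 (z - u) =
      ∫ x in z - d..z, gaussianPDFReal 0 1 x := by
    rw [intervalIntegral.integral_comp_sub_left, sub_zero]
  have hlt : ∫ u in (0 : ℝ)..d, gaussianPDFReal 0 1 (z + u) <
      ∫ u in (0 : ℝ)..d, gaussianPDFReal 0 1 (z - u) := by
    have hl : ∀ u, 0 < u → gaussianPDFReal 0 1 (z + u) < gaussianPDFReal 0 1 (z - u) := by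
      intro u hu
      refine gaussianPDFReal_lt ?_
      rw [abs_of_pos (by linarith : 0 < z + u), abs_lt]
      constructor <;> linarith
    exact intervalIntegral.integral_lt_integral_of_continuousOn_of_le_of_exists_lt hd
      (continuous_gaussianPDFReal.comp (by fun_prop)).continuousOn
      (continuous_gaussianPDFReal.comp (by fun_prop)).continuousOn
      (fun u hu => (hl u hu.1).le) ⟨d, ⟨hd.le, le_rfl⟩, hl d hd⟩
  linarith

lemma cdf_sub_add_cdf_add_lt {z d : ℝ} (hz : 0 < z) (hd : d ≠ 0) :
    cdf (gaussianReal 0 1) (z - d) + cdf (gaussianReal 0 1) (z + d) <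
      2 * cdf (gaussianReal 0 1) z := by
  rcases lt_or_gt_of_ne hd with h | h
  · have := cdf_sub_add_cdf_add_lt_of_pos hz (neg_pos.2 h)
    rw [sub_neg_eq_add, ← sub_eq_add_neg] at this
    linarith
  · exact cdf_sub_add_cdf_add_lt_of_pos hz h

lemma measureReal_lt_abs_add {α : ℝ} (hα : α ∈ Ioo (0 : ℝ) 1) (d : ℝ) :
    (gaussianReal 0 1).real {x | normalQuantile (1 - α / 2) < |x + d|} =
      2 - (cdf (gaussianReal 0 1) (normalQuantile (1 - α / 2) - d) +
        cdf (gaussianReal 0 1) (normalQuantile (1 - α / 2) + d)) := by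
  have hm : MeasurableSet {x : ℝ | |x + d| ≤ normalQuantile (1 - α / 2)} :=
    measurableSet_le (by fun_prop) measurable_const
  have : {x : ℝ | normalQuantile (1 - α / 2) < |x + d|} =
      {x : ℝ | |x + d| ≤ normalQuantile (1 - α / 2)}ᶜ := by
    ext x; simp
  rw [this, probReal_compl_eq_one_sub hm, measureReal_abs_add_le (normalQuantile_pos hα).le]
  ring

lemma measureReal_lt_abs {α : ℝ} (hα : α ∈ Ioo (0 : ℝ) 1) :
    (gaussianReal 0 1).real {x | normalQuantile (1 - α / 2) < |x + 0|} = α := by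
  rw [measureReal_lt_abs_add hα, sub_zero, add_zero,
    cdf_normalQuantile ⟨by linarith [hα.2], by linarith [hα.1]⟩]
  ring

lemma lt_measureReal_lt_abs_add {α d : ℝ} (hα : α ∈ Ioo (0 : ℝ) 1) (hd : d ≠ 0) :
    α < (gaussianReal 0 1).real {x | normalQuantile (1 - α / 2) < |x + d|} := by
  have := cdf_sub_add_cdf_add_lt (normalQuantile_pos hα) hd
  rw [cdf_normalQuantile ⟨by linarith [hα.2], by linarith [hα.1]⟩] at this
  rw [measureReal_lt_abs_add hα]
  linarith

/-! ### The critical index, the randomization and the critical value -/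

lemma binomial_halfI_real_singleton {q k : ℕ} (hk : k ≤ q) :
    (binomial q halfI).real {k} = q.choose k / 2 ^ q := by
  have h : (1 - (halfI : ℝ)) = 1 / 2 := by norm_num [halfI]
  have h' : (halfI : ℝ) = 1 / 2 := rfl
  rw [binomial_real_singleton, h, h', mul_assoc, ← pow_add, Nat.add_sub_cancel' hk]
  simp [div_eq_mul_inv]

lemma binomial_halfI_real_Iio {q b : ℕ} (hb : b ≤ q + 1) :
    (binomial q halfI).real (Iio b) =
      1 / 2 ^ q * ∑ x ∈ Finset.range b, (q.choose x : ℝ) := by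
  have : (Iio b : Set ℕ) = ↑(Finset.range b) := by ext; simp
  rw [this, ← sum_measureReal_singleton, Finset.mul_sum]
  refine Finset.sum_congr rfl fun x hx => ?_
  rw [binomial_halfI_real_singleton (by have := Finset.mem_range.1 hx; omega)]
  ring

lemma binomCDF_natCast {q b : ℕ} (hb : b ≤ q) :
    binomCDF q b = (binomial q halfI).real (Iic b) := by
  have h : (Iic b : Set ℕ) = Iio (b + 1) := by ext; simp
  have h1 : (b : ℝ) ≤ q := Nat.cast_le.2 hb
  rw [h, binomial_halfI_real_Iio (by omega), binomCDF, Nat.floor_natCast]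
  simp [h1, not_lt.2 h1]

lemma binomCDF_natCast_sub_one {q b : ℕ} (hb : b ≤ q) :
    binomCDF q ((b : ℝ) - 1) = (binomial q halfI).real (Iio b) := by
  have h2 : ¬ (q : ℝ) < (b : ℝ) - 1 := by
    have h1 : (b : ℝ) ≤ q := Nat.cast_le.2 hb
    linarith
  rcases b with _ | b
  -- At argument `-1` the natural floor is 0, so the sum is not empty; the indicator of `0 ≤ b`
  -- removes it.
  · rw [binomial_halfI_real_Iio (by omega), binomCDF, if_neg h2]
    norm_num
  · have e : ((b + 1 : ℕ) : ℝ) - 1 = b := by push_cast; ring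
    have h : (Iio (b + 1) : Set ℕ) = Iic b := by ext; simp
    rw [e, h, binomCDF_natCast (by omega)]

/-- The defining property of `b_q(α)`, in terms of the binomial measure. -/
structure IsCriticalIndex (q : ℕ) (α : ℝ) (b : ℕ) : Prop where
  le : b ≤ q
  real_Iio_le : (binomial q halfI).real (Iio b) ≤ α / 2
  lt_real_Iic : α / 2 < (binomial q halfI).real (Iic b)

/-- The least index whose lower tail exceeds `α / 2` lies in the defining set, so the infimum is
attained and is not the default value 0 of an empty set. -/
lemma isCriticalIndex_bq {q : ℕ} {α : ℝ} (hα : 0 < α)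
    (h : α / 2 < (binomial q halfI).real (Iic (q / 2))) : IsCriticalIndex q α (bq q α) := by
  have hne : {b : ℕ | b ≤ q / 2 ∧ binomCDF q ((b : ℝ) - 1) ≤ α / 2 ∧
      α / 2 < binomCDF q b}.Nonempty := by
    classical
    have hex : ∃ b : ℕ, α / 2 < (binomial q halfI).real (Iic b) := ⟨_, h⟩
    have hle : Nat.find hex ≤ q / 2 := Nat.find_min' hex h
    have hle' : Nat.find hex ≤ q := by omega
    refine ⟨Nat.find hex, hle, ?_, ?_⟩
    · rw [binomCDF_natCast_sub_one hle']
      rcases hb : Nat.find hex with _ | b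
      · have : (Iio 0 : Set ℕ) = ∅ := by ext; simp
        rw [this, measureReal_empty]
        positivity
      · have e : (Iio (b + 1) : Set ℕ) = Iic b := by ext; simp
        rw [e]
        exact not_lt.1 (Nat.find_min hex (by omega))
    · rw [binomCDF_natCast hle']
      exact Nat.find_spec hex
  obtain ⟨h1, h2, h3⟩ := Nat.sInf_mem hne
  change bq q α ≤ q / 2 at h1
  change binomCDF q ((bq q α : ℝ) - 1) ≤ α / 2 at h2
  change α / 2 < binomCDF q (bq q α) at h3
  have hle : bq q α ≤ q := by omega
  rw [binomCDF_natCast_sub_one hle] at h2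
  rw [binomCDF_natCast hle] at h3
  exact ⟨hle, h2, h3⟩

/-- `aq` is the fraction of the atom at `bq` that raises the lower tail to exactly `α / 2`. -/
lemma IsCriticalIndex.aq_mem_Icc {q : ℕ} {α : ℝ} (h : IsCriticalIndex q α (bq q α)) :
    aq q α ∈ Icc (0 : ℝ) 1 := by
  have hch : (0 : ℝ) < q.choose (bq q α) := Nat.cast_pos.2 (Nat.choose_pos h.le)
  have hIic : (binomial q halfI).real (Iic (bq q α)) =
      (binomial q halfI).real (Iio (bq q α)) + q.choose (bq q α) / 2 ^ q := by
    have e : (Iic (bq q α) : Set ℕ) = Iio (bq q α + 1) := by ext; simp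
    have := h.le
    rw [e, binomial_halfI_real_Iio (by omega), binomial_halfI_real_Iio (by omega),
      Finset.sum_range_succ]
    ring
  have e : aq q α = (α / 2 - (binomial q halfI).real (Iio (bq q α))) /
      (q.choose (bq q α) / 2 ^ q) := by
    rw [aq, binomCDF_natCast_sub_one h.le, zpow_sub_one₀ two_ne_zero, zpow_natCast]
    field_simp
  have h1 := h.real_Iio_le
  have h2 := h.lt_real_Iic
  rw [hIic] at h2
  rw [e]
  refine ⟨div_nonneg (by linarith) (by positivity), ?_⟩
  rw [div_le_one (by positivity)]
  linarith

/-- The distribution functions of standardized symmetric binomial variables converge. -/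
lemma tendsto_binomial_real_le {q : ℕ → ℕ} (hq : Tendsto q atTop atTop) (y : ℝ) :
    Tendsto (fun n => (binomial (q n) halfI).real
      {k : ℕ | √(q n : ℝ) * (1 / (q n : ℝ) * (k : ℝ) - 1 / 2) ≤ y}) atTop
      (𝓝 (cdf (gaussianReal 0 1) (2 * y))) := by
  have hT := tendstoInDistribution_binomial hq
  rw [← gaussianReal_quarter_real_Iic]
  have h0 : ∀ x : ℝ, (gaussianReal 0 (1 / 4)).map id {x} = 0 := by
    intro x
    rw [Measure.map_id]
    exact gaussianReal_singleton (by norm_num) x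
  have := tendsto_of_Iio_le_of_le_Iic hT.tendsto h0 (tendsto_const_nhds (x := y))
    (g := fun n => (binomial (q n) halfI).real
      {k : ℕ | √(q n : ℝ) * (1 / (q n : ℝ) * (k : ℝ) - 1 / 2) ≤ y}) ?_ ?_
  · simpa only [ProbabilityMeasure.coe_mk, Measure.map_id] using this
  · refine Eventually.of_forall fun n => ?_
    rw [ProbabilityMeasure.coe_mk, map_measureReal_apply (by fun_prop) measurableSet_Iio]
    refine measureReal_mono fun k hk => ?_
    have hk' : √(q n : ℝ) * (1 / (q n : ℝ) * (k : ℝ) - 1 / 2) < y := hk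
    exact hk'.le
  · refine Eventually.of_forall fun n => ?_
    rw [ProbabilityMeasure.coe_mk, map_measureReal_apply (by fun_prop) measurableSet_Iic]
    exact measureReal_mono fun k hk => hk

lemma standardized_mono {q k l : ℕ} (h : k ≤ l) :
    √(q : ℝ) * (1 / (q : ℝ) * (k : ℝ) - 1 / 2) ≤ √(q : ℝ) * (1 / (q : ℝ) * (l : ℝ) - 1 / 2) := by
  gcongr

lemma neg_cq_eq (q : ℕ) (α : ℝ) :
    -cq q α = √(q : ℝ) * (1 / (q : ℝ) * (bq q α : ℝ) - 1 / 2) := by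
  rw [cq]; ring

/-- A standardized threshold `-(z / 4)` is negative, so the indices below it are at most `q / 2`;
its limiting tail is the normal one at `-z / 2`, larger than `α / 2`, the tail at `-z`. -/
lemma eventually_isCriticalIndex_bq {q : ℕ → ℕ} (hq : Tendsto q atTop atTop) {α : ℝ}
    (hα : α ∈ Ioo (0 : ℝ) 1) : ∀ᶠ n in atTop, IsCriticalIndex (q n) α (bq (q n) α) := by
  set z := normalQuantile (1 - α / 2) with hz
  have hz0 : 0 < z := normalQuantile_pos hα
  have hlt : α / 2 < cdf (gaussianReal 0 1) (2 * (-(z / 4))) := by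
    rw [← cdf_neg_normalQuantile hα]
    exact strictMono_cdf_gaussianReal (by linarith)
  filter_upwards [(tendsto_binomial_real_le hq (-(z / 4))).eventually (lt_mem_nhds hlt),
    hq.eventually_gt_atTop 0] with n hn hqn
  refine isCriticalIndex_bq hα.1 (hn.trans_le (measureReal_mono fun k hk => ?_))
  have hq0 : (0 : ℝ) < q n := Nat.cast_pos.2 hqn
  have hs : 0 < √(q n : ℝ) := Real.sqrt_pos.2 hq0
  have hk' : √(q n : ℝ) * (1 / (q n : ℝ) * (k : ℝ) - 1 / 2) ≤ -(z / 4) := hk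
  have h1 : 1 / (q n : ℝ) * (k : ℝ) - 1 / 2 < 0 := by
    by_contra hge
    have := mul_nonneg hs.le (not_lt.1 hge)
    linarith
  have h2 : (k : ℝ) < q n / 2 := by
    have : 1 / (q n : ℝ) * (k : ℝ) < 1 / 2 := by linarith
    field_simp at this
    linarith
  have h3 : 2 * k < q n := by
    have : (2 * k : ℝ) < q n := by linarith
    exact_mod_cast this
  change k ≤ q n / 2
  omega

/-- The critical values converge to half the normal quantile. -/
lemma tendsto_cq {q : ℕ → ℕ} (hq : Tendsto q atTop atTop) {α : ℝ} (hα : α ∈ Ioo (0 : ℝ) 1) :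
    Tendsto (fun n => cq (q n) α) atTop (𝓝 (normalQuantile (1 - α / 2) / 2)) := by
  set z := normalQuantile (1 - α / 2) with hz
  have hΦ := cdf_neg_normalQuantile hα
  rw [tendsto_order]
  constructor
  · intro a ha
    -- The midpoint of `a` and `z / 2` leaves room on both sides: were `cq ≤ a`, all indices
    -- standardized below minus the midpoint would precede `bq`, and their mass could not exceed `α
    -- / 2`.
    have hlt : α / 2 < cdf (gaussianReal 0 1) (2 * -((a + z / 2) / 2)) := by
      rw [← hΦ]
      exact strictMono_cdf_gaussianReal (by linarith)
    filter_upwards [(tendsto_binomial_real_le hq _).eventually (lt_mem_nhds hlt),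
      eventually_isCriticalIndex_bq hq hα] with n h1 h2
    by_contra hc
    refine absurd (h1.trans_le (measureReal_mono (fun k hk => ?_))) (not_lt.2 h2.real_Iio_le)
    by_contra hkb
    have h3 := standardized_mono (q := q n) (not_lt.1 hkb)
    rw [← neg_cq_eq] at h3
    have hk' : √(q n : ℝ) * (1 / (q n : ℝ) * (k : ℝ) - 1 / 2) ≤ -((a + z / 2) / 2) := hk
    linarith [not_lt.1 hc]
  · intro a ha
    have hlt : cdf (gaussianReal 0 1) (2 * -((a + z / 2) / 2)) < α / 2 := by
      rw [← hΦ]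
      exact strictMono_cdf_gaussianReal (by linarith)
    filter_upwards [(tendsto_binomial_real_le hq _).eventually (gt_mem_nhds hlt),
      eventually_isCriticalIndex_bq hq hα] with n h1 h2
    by_contra hc
    refine absurd (h2.lt_real_Iic.trans_le ((measureReal_mono (fun k hk => ?_)))) (not_lt.2 h1.le)
    have h3 := standardized_mono (q := q n) (show k ≤ bq (q n) α from hk)
    rw [← neg_cq_eq] at h3
    change √(q n : ℝ) * (1 / (q n : ℝ) * (k : ℝ) - 1 / 2) ≤ -((a + z / 2) / 2)
    linarith [not_lt.1 hc]

/-! ### Limits of the rejection probability -/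

lemma testStat_eq (q s : ℕ) :
    testStat q s = |√(q : ℝ) * (1 / (q : ℝ) * (s : ℝ) - 1 / 2)| := by
  rw [testStat, abs_mul, abs_of_nonneg (Real.sqrt_nonneg _), one_div_mul_eq_div]

lemma IsCriticalIndex.indicator_le_signTest {q : ℕ} {α : ℝ} (h : IsCriticalIndex q α (bq q α))
    (s : ℕ) : {s | cq q α < testStat q s}.indicator (fun _ => (1 : ℝ)) s ≤ signTest q α s := by
  have ha := h.aq_mem_Icc
  by_cases h1 : cq q α < testStat q s
  · rw [Set.indicator_of_mem (s := {s | cq q α < testStat q s}) h1, signTest, if_pos h1]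
  · rw [Set.indicator_of_notMem (s := {s | cq q α < testStat q s}) h1, signTest, if_neg h1]
    split_ifs
    exacts [ha.1, le_rfl]

lemma IsCriticalIndex.signTest_le_indicator {q : ℕ} {α : ℝ} (h : IsCriticalIndex q α (bq q α))
    (s : ℕ) : signTest q α s ≤ {s | cq q α ≤ testStat q s}.indicator (fun _ => (1 : ℝ)) s := by
  have ha := h.aq_mem_Icc
  by_cases h1 : cq q α ≤ testStat q s
  · rw [Set.indicator_of_mem (s := {s | cq q α ≤ testStat q s}) h1, signTest]
    split_ifs
    exacts [le_rfl, ha.2, zero_le_one]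
  · rw [Set.indicator_of_notMem (s := {s | cq q α ≤ testStat q s}) h1, signTest,
      if_neg fun h2 => h1 h2.le, if_neg fun h2 => h1 h2.symm.le]

section

variable {Ω : Type*} [MeasurableSpace Ω] {μ : Measure Ω} {S : Ω → ℕ} {q : ℕ} {α : ℝ}

lemma integral_indicator_comp (hS : AEMeasurable S μ) (A : Set ℕ) :
    ∫ ω, A.indicator (fun _ => (1 : ℝ)) (S ω) ∂μ = (μ.map S).real A := by
  rw [← integral_map (φ := S) (f := A.indicator (fun _ => (1 : ℝ))) hS (by fun_prop),
    integral_indicator_const _ (MeasurableSet.of_discrete)]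
  simp

variable [IsProbabilityMeasure μ]

lemma integrable_comp_of_abs_le (hS : AEMeasurable S μ) {g : ℕ → ℝ} (hg : ∀ s, |g s| ≤ 1) :
    Integrable (fun ω => g (S ω)) μ :=
  Integrable.of_bound (measurable_from_top.comp_aemeasurable hS).aestronglyMeasurable 1
    (Eventually.of_forall fun ω => hg (S ω))

lemma abs_indicator_le_one (A : Set ℕ) (s : ℕ) : |A.indicator (fun _ => (1 : ℝ)) s| ≤ 1 := by
  by_cases h : s ∈ A <;> simp [h]

lemma IsCriticalIndex.abs_signTest_le_one (h : IsCriticalIndex q α (bq q α)) (s : ℕ) :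
    |signTest q α s| ≤ 1 := by
  have h1 := h.indicator_le_signTest s
  have h2 := h.signTest_le_indicator s
  rw [abs_le]
  constructor
  · linarith [neg_le_of_abs_le (abs_indicator_le_one {s | cq q α < testStat q s} s)]
  · linarith [le_of_abs_le (abs_indicator_le_one {s | cq q α ≤ testStat q s} s)]

lemma IsCriticalIndex.real_le_integral_signTest (h : IsCriticalIndex q α (bq q α))
    (hS : AEMeasurable S μ) :
    (μ.map S).real {s | cq q α < testStat q s} ≤ ∫ ω, signTest q α (S ω) ∂μ := by
  rw [← integral_indicator_comp hS]
  exact integral_mono (integrable_comp_of_abs_le hS (abs_indicator_le_one _))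
    (integrable_comp_of_abs_le hS h.abs_signTest_le_one) fun ω => h.indicator_le_signTest _

lemma IsCriticalIndex.integral_signTest_le_real (h : IsCriticalIndex q α (bq q α))
    (hS : AEMeasurable S μ) :
    ∫ ω, signTest q α (S ω) ∂μ ≤ (μ.map S).real {s | cq q α ≤ testStat q s} := by
  rw [← integral_indicator_comp hS]
  exact integral_mono (integrable_comp_of_abs_le hS h.abs_signTest_le_one)
    (integrable_comp_of_abs_le hS (abs_indicator_le_one _)) fun ω => h.signTest_le_indicator _

end

variable {Ω : ℕ → Type*} [∀ n, MeasurableSpace (Ω n)] {μ : ∀ n, Measure (Ω n)}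
  [∀ n, IsProbabilityMeasure (μ n)] {q : ℕ → ℕ} {S : ∀ n, Ω n → ℕ} {α : ℝ}

/-- The limiting rejection probability when the standardized sign statistic is asymptotically
normal. -/
theorem tendsto_integral_signTest (hq : Tendsto q atTop atTop)
    (hS : ∀ n, AEMeasurable (S n) (μ n)) {D : ℝ}
    (h : TendstoInDistribution (fun n ω => √(q n : ℝ) * (1 / (q n : ℝ) * (S n ω : ℝ) - 1 / 2))
      atTop (id : ℝ → ℝ) μ (gaussianReal D (1 / 4))) (hα : α ∈ Ioo (0 : ℝ) 1) :
    Tendsto (fun n => ∫ ω, signTest (q n) α (S n ω) ∂(μ n)) atTop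
      (𝓝 ((gaussianReal 0 1).real {x : ℝ | normalQuantile (1 - α / 2) < |x + 2 * D|})) := by
  have habs := h.continuous_comp (g := fun x : ℝ => |x|) continuous_abs
  have h0 : ∀ x : ℝ, (gaussianReal D (1 / 4)).map ((fun x : ℝ => |x|) ∘ id) {x} = 0 := by
    intro x
    rw [Function.comp_id, Measure.map_apply (by fun_prop) (measurableSet_singleton x)]
    refine measure_mono_null (t := {x} ∪ {-x}) ?_ (measure_union_null
      (gaussianReal_singleton (by norm_num) x) (gaussianReal_singleton (by norm_num) (-x)))
    intro y hy
    have hy' : |y| = x := hy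
    rcases abs_eq_abs.1 (by rw [← hy', abs_abs] : |y| = |x|) with h | h <;> simp [h]
  have hlaw : ∀ n (A : Set ℝ), MeasurableSet A →
      ((μ n).map ((fun x : ℝ => |x|) ∘ fun ω =>
        √(q n : ℝ) * (1 / (q n : ℝ) * (S n ω : ℝ) - 1 / 2))).real A =
      ((μ n).map (S n)).real {s | testStat (q n) s ∈ A} := by
    intro n A hA
    have hm : Measurable fun s : ℕ => testStat (q n) s := measurable_from_top
    have e : ((fun x : ℝ => |x|) ∘ fun ω =>
        √(q n : ℝ) * (1 / (q n : ℝ) * (S n ω : ℝ) - 1 / 2)) =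
        (fun s : ℕ => testStat (q n) s) ∘ S n := by
      ext ω; simp [testStat_eq]
    rw [e, ← AEMeasurable.map_map_of_aemeasurable hm.aemeasurable (hS n),
      map_measureReal_apply hm hA]
    rfl
  -- Whatever the randomization, the acceptance probability lies between the probabilities of `T <
  -- c` and `T ≤ c`.
  have key := tendsto_of_Iio_le_of_le_Iic habs.tendsto h0 (tendsto_cq hq hα)
    (g := fun n => 1 - ∫ ω, signTest (q n) α (S n ω) ∂(μ n)) ?_ ?_
  · have := key.const_sub 1
    simp only [sub_sub_cancel] at this
    refine this.trans_eq ?_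
    congr 1
    have hm : MeasurableSet {x : ℝ | |x + 2 * D| ≤ normalQuantile (1 - α / 2)} :=
      measurableSet_le (by fun_prop) measurable_const
    have e : {x : ℝ | normalQuantile (1 - α / 2) < |x + 2 * D|} =
        {x : ℝ | |x + 2 * D| ≤ normalQuantile (1 - α / 2)}ᶜ := by
      ext x; simp
    rw [e, probReal_compl_eq_one_sub hm, ProbabilityMeasure.coe_mk, Function.comp_id,
      gaussianReal_quarter_eq_map, Measure.map_map (by fun_prop) (by fun_prop),
      map_measureReal_apply (by fun_prop) measurableSet_Iic]
    congr 2
    ext x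
    simp only [mem_preimage, Function.comp_apply, mem_Iic, mem_ofPred_eq]
    rw [show 1 / 2 * x + D = 1 / 2 * (x + 2 * D) by ring, abs_mul,
      abs_of_pos (by norm_num : (0 : ℝ) < 1 / 2)]
    constructor <;> intro h <;> linarith
  · filter_upwards [eventually_isCriticalIndex_bq hq hα] with n hn
    have h1 := hn.integral_signTest_le_real (hS n)
    have := Measure.isProbabilityMeasure_map (hS n)
    have e : {s | cq (q n) α ≤ testStat (q n) s} =
        {s | testStat (q n) s ∈ Iio (cq (q n) α)}ᶜ := by
      ext s; simp
    rw [e, probReal_compl_eq_one_sub MeasurableSet.of_discrete] at h1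
    rw [ProbabilityMeasure.coe_mk, hlaw n _ measurableSet_Iio]
    linarith
  · filter_upwards [eventually_isCriticalIndex_bq hq hα] with n hn
    have h1 := hn.real_le_integral_signTest (hS n)
    have := Measure.isProbabilityMeasure_map (hS n)
    have e : {s | cq (q n) α < testStat (q n) s} =
        {s | testStat (q n) s ∈ Iic (cq (q n) α)}ᶜ := by
      ext s; simp
    rw [e, probReal_compl_eq_one_sub MeasurableSet.of_discrete] at h1
    rw [ProbabilityMeasure.coe_mk, hlaw n _ measurableSet_Iic]
    linarith

/-- Tightness by the portmanteau inequality for closed sets, whose limiting masses decrease to zero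
as `M` grows. -/
lemma eventually_measureReal_le_abs_lt {ν : ℕ → ProbabilityMeasure ℝ} {ν₀ : ProbabilityMeasure ℝ}
    (hν : Tendsto ν atTop (𝓝 ν₀)) {ε : ℝ} (hε : 0 < ε) :
    ∃ M : ℝ, ∀ᶠ n in atTop, (ν n : Measure ℝ).real {x | M ≤ |x|} < ε := by
  have hc : ∀ M : ℝ, IsClosed {x : ℝ | M ≤ |x|} := fun M => isClosed_le continuous_const
    continuous_abs
  have hlim : Tendsto (fun k : ℕ => (ν₀ : Measure ℝ) {x : ℝ | (k : ℝ) ≤ |x|}) atTop (𝓝 0) := by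
    have hI : ⋂ k : ℕ, {x : ℝ | (k : ℝ) ≤ |x|} = ∅ := by
      rw [eq_empty_iff_forall_notMem]
      intro x hx
      obtain ⟨k, hk⟩ := exists_nat_gt |x|
      exact absurd (mem_iInter.1 hx k) (not_le.2 hk)
    have := tendsto_measure_iInter_atTop (μ := (ν₀ : Measure ℝ))
      (s := fun k : ℕ => {x : ℝ | (k : ℝ) ≤ |x|})
      (fun k => (hc k).measurableSet.nullMeasurableSet)
      (fun k l hkl x (hx : (l : ℝ) ≤ |x|) => (Nat.cast_le.2 hkl).trans hx)
      ⟨0, measure_ne_top _ _⟩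
    rwa [hI, measure_empty] at this
  obtain ⟨k, hk⟩ := (hlim.eventually (gt_mem_nhds (ENNReal.ofReal_pos.2 hε))).exists
  refine ⟨k, ?_⟩
  have := (ProbabilityMeasure.limsup_measure_closed_le_of_tendsto hν (hc k)).trans_lt hk
  filter_upwards [eventually_lt_of_limsup_lt this] with n hn
  rw [measureReal_def]
  exact (ENNReal.lt_ofReal_iff_toReal_lt (measure_ne_top _ _)).1 hn

/-- The test is consistent when the centred sign statistic is tight and the centring is not
`1 / 2`. -/
theorem tendsto_integral_signTest_one (hq : Tendsto q atTop atTop)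
    (hS : ∀ n, AEMeasurable (S n) (μ n)) {p : ℝ} {ν : Measure ℝ} [IsProbabilityMeasure ν]
    (h : TendstoInDistribution (fun n ω => √(q n : ℝ) * (1 / (q n : ℝ) * (S n ω : ℝ) - p))
      atTop (id : ℝ → ℝ) μ ν) (hp : p ≠ 1 / 2) (hα : α ∈ Ioo (0 : ℝ) 1) :
    Tendsto (fun n => ∫ ω, signTest (q n) α (S n ω) ∂(μ n)) atTop (𝓝 1) := by
  have hsqrt : Tendsto (fun n => √(q n : ℝ)) atTop atTop :=
    Real.tendsto_sqrt_atTop.comp (tendsto_natCast_atTop_atTop.comp hq)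
  have hgap : Tendsto (fun n => √(q n : ℝ) * |p - 1 / 2|) atTop atTop :=
    hsqrt.atTop_mul_const (abs_pos.2 (sub_ne_zero.2 hp))
  have hbd : ∀ᶠ n in atTop, cq (q n) α < normalQuantile (1 - α / 2) / 2 + 1 :=
    (tendsto_cq hq hα).eventually (gt_mem_nhds (by linarith))
  rw [tendsto_order]
  constructor
  · intro a ha
    obtain ⟨M, hM⟩ := eventually_measureReal_le_abs_lt h.tendsto (sub_pos.2 ha)
    filter_upwards [hM, hbd, hgap.eventually_ge_atTop (normalQuantile (1 - α / 2) / 2 + 1 + M),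
      eventually_isCriticalIndex_bq hq hα] with n h1 h2 h3 h4
    have h5 := h4.real_le_integral_signTest (hS n)
    have := Measure.isProbabilityMeasure_map (hS n)
    have hm : Measurable fun s : ℕ => √(q n : ℝ) * (1 / (q n : ℝ) * (s : ℝ) - p) :=
      measurable_from_top
    have e : (fun ω => √(q n : ℝ) * (1 / (q n : ℝ) * (S n ω : ℝ) - p)) =
        (fun s : ℕ => √(q n : ℝ) * (1 / (q n : ℝ) * (s : ℝ) - p)) ∘ S n := rfl
    rw [ProbabilityMeasure.coe_mk, e, ← AEMeasurable.map_map_of_aemeasurable hm.aemeasurable (hS n),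
      map_measureReal_apply hm (measurableSet_le measurable_const (by fun_prop))] at h1
    have h6 : ((μ n).map (S n)).real {s | cq (q n) α < testStat (q n) s}ᶜ ≤
        ((μ n).map (S n)).real ((fun s : ℕ => √(q n : ℝ) * (1 / (q n : ℝ) * (s : ℝ) - p)) ⁻¹'
          {x | M ≤ |x|}) := by
      refine measureReal_mono fun s hs => ?_
      have hs' : testStat (q n) s ≤ cq (q n) α := not_lt.1 hs
      change M ≤ |√(q n : ℝ) * (1 / (q n : ℝ) * (s : ℝ) - p)|
      rw [testStat_eq] at hs'
      -- On acceptance the statistic centred at `1 / 2` is bounded while the drift diverges, so the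
      -- statistic centred at `p` must exceed `M`.
      have h7 := abs_sub_abs_le_abs_sub (√(q n : ℝ) * (p - 1 / 2))
        (√(q n : ℝ) * (1 / (q n : ℝ) * (s : ℝ) - 1 / 2))
      rw [show √(q n : ℝ) * (p - 1 / 2) - √(q n : ℝ) * (1 / (q n : ℝ) * (s : ℝ) - 1 / 2) =
        -(√(q n : ℝ) * (1 / (q n : ℝ) * (s : ℝ) - p)) by ring, abs_neg, abs_mul,
        abs_of_nonneg (Real.sqrt_nonneg _)] at h7
      linarith
    rw [probReal_compl_eq_one_sub MeasurableSet.of_discrete] at h6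
    linarith
  · intro a ha
    filter_upwards [eventually_isCriticalIndex_bq hq hα] with n hn
    have := Measure.isProbabilityMeasure_map (hS n)
    exact ((hn.integral_signTest_le_real (hS n)).trans measureReal_le_one).trans_lt ha

end SignTest

/-! ### The theorem -/

theorem theorem4p3
    {Ω : ℕ → Type*} [∀ n, MeasurableSpace (Ω n)]
    (μ : ∀ n, Measure (Ω n)) [∀ n, IsProbabilityMeasure (μ n)]
    (q : ℕ → ℕ) (hq : Tendsto q atTop atTop)
    (hrate : Tendsto (fun n : ℕ => (q n : ℝ) ^ (3 / 2 : ℝ) / (n : ℝ)) atTop (𝓝 0))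
    (Z : ∀ n, Fin n → Ω n → ℝ) (S : ∀ n, Ω n → ℕ)
    (hS : ∀ n, AEMeasurable (S n) (μ n))
    (hSZ : ∀ n ω, SignTest.IsSignStatistic (q n) (fun i => Z n i ω) (S n ω)) :
    -- fixed distribution
    (∀ (P : Measure ℝ) [IsProbabilityMeasure P] (f : ℝ → ℝ) (δ C fm fp : ℝ),
      (∀ n, SignTest.IsIIDSample (μ n) P (Z n)) →
      SignTest.HasLipschitzDensity P f δ C fm fp →
      0 < fm + fp →
      TendstoInDistribution
          (fun n ω => √(q n : ℝ) * (1 / (q n : ℝ) * (S n ω : ℝ) - SignTest.piF fm fp)) atTop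
          (id : ℝ → ℝ) μ
          (gaussianReal 0 (SignTest.piF fm fp * (1 - SignTest.piF fm fp)).toNNReal) ∧
        ∀ α ∈ Ioo (0 : ℝ) 1,
          (fp = fm →
            Tendsto (fun n => ∫ ω, SignTest.signTest (q n) α (S n ω) ∂(μ n)) atTop (𝓝 α)) ∧
          (fp ≠ fm →
            Tendsto (fun n => ∫ ω, SignTest.signTest (q n) α (S n ω) ∂(μ n)) atTop (𝓝 1))) ∧
    -- distributions local to the null hypothesis
    (∀ (P : ℕ → Measure ℝ) [∀ n, IsProbabilityMeasure (P n)] (f : ℕ → ℝ → ℝ)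
      (δ C κ : ℝ) (fm fp : ℕ → ℝ) (Δ : ℝ),
      (∀ n, SignTest.IsIIDSample (μ n) (P n) (Z n)) →
      (∀ n, SignTest.HasLipschitzDensity (P n) (f n) δ C (fm n) (fp n)) →
      0 < κ → (∀ n, κ ≤ fm n + fp n) →
      Tendsto (fun n => √(q n : ℝ) * (SignTest.piF (fm n) (fp n) - 1 / 2)) atTop (𝓝 Δ) →
      Δ ≠ 0 →
      ∀ α ∈ Ioo (0 : ℝ) 1,
        Tendsto (fun n => ∫ ω, SignTest.signTest (q n) α (S n ω) ∂(μ n)) atTop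
            (𝓝 ((gaussianReal 0 1).real
              {x : ℝ | SignTest.normalQuantile (1 - α / 2) < |x + 2 * Δ|})) ∧
          α < (gaussianReal 0 1).real
            {x : ℝ | SignTest.normalQuantile (1 - α / 2) < |x + 2 * Δ|}) := by
  have hsqrt : Tendsto (fun n => √(q n : ℝ)) atTop atTop :=
    Real.tendsto_sqrt_atTop.comp (tendsto_natCast_atTop_atTop.comp hq)
  refine ⟨fun P _ f δ C fm fp hZ hf hpos => ?_, fun P _ f δ C κ fm fp Δ hZ hf hκ hκf hΔ hΔ0 α hα =>
    ⟨?_, SignTest.lt_measureReal_lt_abs_add hα (mul_ne_zero two_ne_zero hΔ0)⟩⟩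
  · have hp := hf.piF_mem_Icc hpos
    have hchar := SignTest.tendsto_integral_exp_pow_sub hq hrate hS hSZ (P := fun _ => P)
      (f := fun _ => f) hZ (fun _ => hf) hpos (fun _ => le_rfl)
    have hclt := SignTest.tendstoInDistribution_of_charFun_sub_tendsto hq hS (fun _ => hp)
      tendsto_const_nhds (d := fun _ => 0) tendsto_const_nhds hchar
    simp only [add_zero] at hclt
    refine ⟨hclt, fun α hα => ⟨fun heq => ?_, fun hne => ?_⟩⟩
    · have hhalf : SignTest.piF fm fp = 1 / 2 := by
        rw [SignTest.piF, heq, div_eq_div_iff (by linarith) two_ne_zero]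
        ring
      rw [hhalf] at hclt
      have e : (1 / 2 * (1 - 1 / 2) : ℝ).toNNReal = 1 / 4 := by
        ext; rw [Real.coe_toNNReal _ (by norm_num)]; norm_num
      rw [e] at hclt
      have := SignTest.tendsto_integral_signTest hq hS hclt hα
      rwa [mul_zero, SignTest.measureReal_lt_abs hα] at this
    · refine SignTest.tendsto_integral_signTest_one hq hS hclt ?_ hα
      rw [SignTest.piF]
      intro h
      field_simp at h
      exact hne (by linarith)
  · have hhalf : Tendsto (fun n => SignTest.piF (fm n) (fp n)) atTop (𝓝 (1 / 2)) := by
      -- Dividing by `√q` forces `piF` to `1 / 2`, so the limiting variance is `1 / 4`.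
      have h1 := hΔ.div_atTop hsqrt
      have h2 : Tendsto (fun n => SignTest.piF (fm n) (fp n) - 1 / 2) atTop (𝓝 0) := by
        refine h1.congr' ?_
        filter_upwards [hsqrt.eventually_gt_atTop 0] with n hn
        field_simp
      have h3 := h2.add_const (1 / 2)
      rw [zero_add] at h3
      exact h3.congr fun n => sub_add_cancel _ _
    have hv : Tendsto (fun n => SignTest.piF (fm n) (fp n) * (1 - SignTest.piF (fm n) (fp n)))
        atTop (𝓝 (1 / 2 * (1 - 1 / 2))) := hhalf.mul (hhalf.const_sub 1)
    have hclt := SignTest.tendstoInDistribution_of_charFun_sub_tendsto hq hS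
      (fun n => (hf n).piF_mem_Icc (hκ.trans_le (hκf n))) hv hΔ
      (SignTest.tendsto_integral_exp_pow_sub hq hrate hS hSZ hZ hf hκ hκf)
    have e : (1 / 2 * (1 - 1 / 2) : ℝ).toNNReal = 1 / 4 := by
      ext; rw [Real.coe_toNNReal _ (by norm_num)]; norm_num
    rw [e] at hclt
    -- Centring at `piF` and adding the drift `√q * (piF - 1 / 2)` amounts to centring at `1 / 2`.
    refine SignTest.tendsto_integral_signTest hq hS (hclt.congr (fun n => ?_) EventuallyEq.rfl) hα
    refine Eventually.of_forall fun ω => ?_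
    simp only
    ring
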